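/- Let $n \ge 3$ and $m \ge 1$, let $|\cdot|$ be the Euclidean norm, and let $\mathbb{B}^k = \{x \in \mathbb{R}^k : |x| < 1\}$. A $C^2$ mapping $u:\mathbb{B}^n\to\mathbb{R}^m$ is called harmonic if $\Delta u = 0$ on $\mathbb{B}^n$, and hyperbolic harmonic if $\Delta_h u = 0$ on $\mathbb{B}^n$, where $$\Delta_h u(x) = (1-|x|^2)^2\,\Delta u(x) + 2(n-2)(1-|x|^2)\sum_{i=1}^n x_i\,\frac{\partial u}{\partial x_i}(x)$$ (both operators act on each component of $u$). Let $h:\mathbb{B}^n\to\mathbb{B}^m$ and, when $h$ is differentiable at $x$, put $|Dh(x)| = \sup_{|v|=1}|Dh(x)v|$. If $h$ is harmonic, then $$|Dh(x)| \le \frac{n}{2}\cdot\frac{1}{1-|x|}\qquad\text{for all } x\in\mathbb{B}^n.$$ If $h$ is hyperbolic harmonic, then $$|Dh(x)| \le (n-1)\cdot\frac{1}{1-|x|^2}\qquad\text{for all } x\in\mathbb{B}^n.$$ -/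

import Mathlib

noncomputable section

/-- The open unit ball of Euclidean `n`-space. -/
def unitBall (n : ℕ) : Set (EuclideanSpace ℝ (Fin n)) :=
  Metric.ball 0 1

/-- The hyperbolic Laplacian
`(1 - |x|²)² Δu(x) + 2 (n - 2) (1 - |x|²) ∑ i, x_i ∂u/∂x_i(x)` at a point `x` of the unit ball.
For vector-valued `u` it acts on each component, as do `Δ` and the partial derivatives. -/
def hyperbolicLaplacian {n : ℕ} {F : Type*} [NormedAddCommGroup F] [NormedSpace ℝ F]
    (u : EuclideanSpace ℝ (Fin n) → F) (x : EuclideanSpace ℝ (Fin n)) : F :=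
  ((1 - ‖x‖ ^ 2) ^ 2) • Laplacian.laplacian u x +
    (2 * ((n : ℝ) - 2) * (1 - ‖x‖ ^ 2)) •
      ∑ i : Fin n, x i • fderiv ℝ u x (EuclideanSpace.single i 1)

/-- `u` is hyperbolic harmonic on the open unit ball: twice continuously differentiable and
annihilated by the hyperbolic Laplacian. -/
def IsHyperbolicHarmonicOnBall {n : ℕ} {F : Type*} [NormedAddCommGroup F] [NormedSpace ℝ F]
    (u : EuclideanSpace ℝ (Fin n) → F) : Prop :=
  ContDiffOn ℝ 2 u (unitBall n) ∧ ∀ x ∈ unitBall n, hyperbolicLaplacian u x = 0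

end

/-! Both equations belong to one family, written weakly with weight `(1 - τ|x|²)^(2-d)` in dimension
`d`: `τ = 0` is the flat case, `τ = 1` the hyperbolic one. The core is a bound at the centre for
scalar solutions with `|u| ≤ M`, namely `|∇u(0)| ≤ (d + τ(d-2))/2 · M`, which is `d/2 · M` or `(d-1)
· M`.

The field `X = (1 + τ|x|²)e - 2τ⟪e,x⟫x` generates translations of the metric `|dx|²/(1 - τ|x|²)²`,
so `Xu` should solve the same equation and have the mean value property at `0`. No second derivative
of `Xu` is needed. `IsWeaklyHarmonic.integral_translationDeriv_mul_div` shows that `Xu` annihilates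
the divergences of radial fields, and `integral_mul_radial_eq_of_integral_mul_div_eq_zero` turns
this into `∫ Xu · g(|x|²) = Xu(0) ∫ g(|x|²)`, where `Xu(0) = ∂u/∂e(0)`.

Take for `g` a cutoff times the volume density `(1 - τ|x|²)^(-d)`. Since `X` preserves that volume,
integrating by parts leaves only the derivative of the cutoff, concentrated near the unit sphere.
There `|u| ≤ M`, and the spherical mean of `|⟪e,ζ⟫|` is at most `1/2` when `d ≥ 3`. A second radial
divergence identity compares the remaining integral with `∫ g(|x|²)`; see
`IsWeaklyHarmonic.abs_fderiv_zero_mul_le`.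

For another point `a`, `IsWeaklyHarmonic.comp` carries the centre to `a`: by a similarity onto the
ball of radius `1 - |a|` about `a` in the flat case, by an inversion exchanging `0` and `a` in the
hyperbolic case. A vector-valued `h` is handled through the scalar functions `⟪w, h⟫`, bounded by
`‖w‖`. -/

open MeasureTheory Set Metric Real Module
open scoped RealInnerProductSpace

/-! ### Spherical mean of a linear form, computed with Gaussians. -/

section SphereAverage

variable {E : Type*} [NormedAddCommGroup E] [InnerProductSpace ℝ E] [FiniteDimensional ℝ E]
  [MeasurableSpace E] [BorelSpace E]

/-- Integration in polar coordinates of a function that separates into an angular and a radial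
factor. -/
theorem integral_angular_mul_radial [Nontrivial E] (Φ : E → ℝ) (f : ℝ → ℝ) :
    ∫ x : E, Φ (‖x‖⁻¹ • x) * f ‖x‖ =
      (∫ ζ : sphere (0 : E) 1, Φ ζ ∂(volume : Measure E).toSphere) *
        ∫ r in Ioi (0 : ℝ), r ^ (finrank ℝ E - 1) * f r := by
  calc
    ∫ x : E, Φ (‖x‖⁻¹ • x) * f ‖x‖
        = ∫ x : ({(0)}ᶜ : Set E), Φ (‖x.1‖⁻¹ • x.1) * f ‖x.1‖ ∂(volume.comap Subtype.val) := by
      rw [integral_subtype_comap (measurableSet_singleton _).compl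
        fun x : E ↦ Φ (‖x‖⁻¹ • x) * f ‖x‖, restrict_compl_singleton]
    _ = ∫ z : sphere (0 : E) 1 × Ioi (0 : ℝ), Φ z.1 * f z.2
          ∂(volume : Measure E).toSphere.prod (.volumeIoiPow (finrank ℝ E - 1)) := by
      simpa [Function.comp_def] using
        (volume : Measure E).measurePreserving_homeomorphUnitSphereProd.integral_comp
        (Homeomorph.measurableEmbedding _)
        (fun z : sphere (0 : E) 1 × Ioi (0 : ℝ) ↦ Φ z.1 * f z.2)
    _ = (∫ ζ : sphere (0 : E) 1, Φ ζ ∂(volume : Measure E).toSphere) *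
          ∫ r : Ioi (0 : ℝ), f r ∂.volumeIoiPow (finrank ℝ E - 1) :=
      integral_prod_mul (fun ζ : sphere (0 : E) 1 ↦ Φ ζ) (fun r : Ioi (0 : ℝ) ↦ f r)
    _ = _ := by
      congr 1
      simp only [Measure.volumeIoiPow, ENNReal.ofReal]
      rw [integral_withDensity_eq_integral_smul,
        integral_subtype_comap measurableSet_Ioi
          fun a ↦ Real.toNNReal (a ^ (finrank ℝ E - 1)) • f a,
        setIntegral_congr_fun measurableSet_Ioi fun x hx ↦ ?_]
      · rw [NNReal.smul_def, Real.coe_toNNReal _ (pow_nonneg hx.out.le _), smul_eq_mul]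
      · exact (measurable_subtype_coe.pow_const _).real_toNNReal

theorem integral_Ioi_pow_mul_exp_neg_sq (k : ℕ) :
    ∫ r in Ioi (0 : ℝ), r ^ k * exp (-r ^ 2) = Gamma ((k + 1 : ℝ) / 2) / 2 := by
  have h := integral_rpow_mul_exp_neg_rpow (p := 2) (q := k) two_pos
    (by have : (0 : ℝ) ≤ k := k.cast_nonneg; linarith)
  simp only [rpow_natCast, rpow_two] at h
  rw [h]; ring

theorem integral_abs_mul_exp_neg_sq : ∫ t : ℝ, |t| * exp (-t ^ 2) = 1 := by
  have h := integral_comp_abs (f := fun t ↦ t * exp (-t ^ 2))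
  simp only [sq_abs] at h
  have h1 := integral_Ioi_pow_mul_exp_neg_sq 1
  simp only [pow_one] at h1
  rw [h, h1]
  norm_num

theorem integral_exp_neg_sq : ∫ t : ℝ, exp (-t ^ 2) = √π := by
  simpa using integral_gaussian 1

theorem integral_exp_neg_norm_sq :
    ∫ x : E, exp (-‖x‖ ^ 2) = √π ^ finrank ℝ E := by
  have h := GaussianFourier.integral_rexp_neg_mul_sq_norm (V := E) one_pos
  simp only [neg_mul, one_mul, div_one] at h
  rw [h, sqrt_eq_rpow, ← rpow_natCast, ← rpow_mul pi_pos.le]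
  congr 1; ring

/-- In an orthonormal basis containing `e` the integrand is a product of one-variable functions: one
factor integrates to `1`, each of the others to `√π`. -/
theorem integral_abs_inner_mul_exp_neg_norm_sq {e : E} (he : ‖e‖ = 1) :
    ∫ x : E, |⟪e, x⟫| * exp (-‖x‖ ^ 2) = √π ^ (finrank ℝ E - 1) := by
  have hpos : 0 < finrank ℝ E := by
    have : Nontrivial E := ⟨e, 0, by rintro rfl; simp at he⟩
    exact finrank_pos
  let i₀ : Fin (finrank ℝ E) := ⟨0, hpos⟩
  obtain ⟨b, hb⟩ := Orthonormal.exists_orthonormalBasis_extension_of_card_eq (𝕜 := ℝ) (E := E)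
    (ι := Fin (finrank ℝ E)) (by simp) (v := fun _ ↦ e) (s := {i₀})
    ⟨fun i ↦ by simp [he], fun i j hij ↦ absurd (Subsingleton.elim i j) hij⟩
  have hb0 : b i₀ = e := hb i₀ rfl
  let φ : Fin (finrank ℝ E) → ℝ → ℝ := fun i t ↦ (if i = i₀ then |t| else 1) * exp (-t ^ 2)
  have h1 : ∀ x : E, |⟪e, x⟫| * exp (-‖x‖ ^ 2) = ∏ i, φ i ((b.repr x) i) := by
    intro x
    rw [Finset.prod_mul_distrib, ← exp_sum, Finset.sum_neg_distrib]
    congr 1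
    · simp [b.repr_apply_apply, hb0]
    · rw [← b.repr.norm_map x, EuclideanSpace.norm_sq_eq]; simp
  simp_rw [h1]
  rw [b.measurePreserving_repr.integral_comp b.repr.toHomeomorph.measurableEmbedding
    (fun y : EuclideanSpace ℝ (Fin (finrank ℝ E)) ↦ ∏ i, φ i (y i)),
    (PiLp.volume_preserving_ofLp (Fin (finrank ℝ E))).integral_comp
      (MeasurableEquiv.toLp 2 (Fin (finrank ℝ E) → ℝ)).symm.measurableEmbedding
      (fun y ↦ ∏ i, φ i (y i)),
    integral_fintype_prod_volume_eq_prod, ← Finset.mul_prod_erase _ _ (Finset.mem_univ i₀)]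
  have h2 : ∫ t, φ i₀ t = 1 := by simpa [φ] using integral_abs_mul_exp_neg_sq
  rw [h2, one_mul, Finset.prod_congr rfl (g := fun _ ↦ √π)]
  · simp
  · intro i hi
    simpa [φ, Finset.ne_of_mem_erase hi] using integral_exp_neg_sq

/-- The spherical mean of `|⟪e,ζ⟫|` is `Γ(n/2) / (√π Γ((n+1)/2))`, so this says that it is at most
`1/2`. Equality holds at `n = 3`; passing from `k` to `k + 2` multiplies the ratio by `k/(k+1) < 1`.
-/
theorem two_mul_Gamma_half_le (n : ℕ) (hn : 3 ≤ n) :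
    2 * Gamma ((n : ℝ) / 2) ≤ √π * Gamma (((n : ℝ) + 1) / 2) := by
  have h32 : Gamma (3 / 2) = √π / 2 := by
    rw [show (3 / 2 : ℝ) = 1 / 2 + 1 by norm_num, Gamma_add_one (by norm_num), Gamma_one_half_eq]
    ring
  induction n using Nat.strong_induction_on with
  | _ n ih =>
    obtain rfl | rfl | h5 : n = 3 ∨ n = 4 ∨ 5 ≤ n := by omega
    · norm_num
      rw [h32]; linarith [sqrt_nonneg π]
    · norm_num
      rw [show (5 / 2 : ℝ) = 3 / 2 + 1 by norm_num, Gamma_add_one (by norm_num), h32]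
      nlinarith [sq_sqrt pi_pos.le, pi_gt_three]
    · obtain ⟨k, rfl⟩ : ∃ k, n = k + 2 := ⟨n - 2, by omega⟩
      have h := ih k (by omega) (by omega)
      have hk : (0 : ℝ) < k := by exact_mod_cast (by omega : 0 < k)
      push_cast
      rw [show ((k : ℝ) + 2) / 2 = k / 2 + 1 by ring,
        show ((k : ℝ) + 2 + 1) / 2 = (k + 1) / 2 + 1 by ring, Gamma_add_one (by positivity),
        Gamma_add_one (by positivity)]
      have hG : 0 < Gamma (((k : ℝ) + 1) / 2) := Gamma_pos_of_pos (by positivity)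
      have := mul_nonneg (sqrt_nonneg π) hG.le
      nlinarith

/-- In dimension at least three the mean of `|⟪e, ζ⟫|` over the unit sphere is at most `1 / 2`. -/
theorem integral_toSphere_abs_inner_le (hE : 3 ≤ finrank ℝ E) {e : E} (he : ‖e‖ = 1) :
    ∫ ζ : sphere (0 : E) 1, |⟪e, (ζ : E)⟫| ∂(volume : Measure E).toSphere ≤
      1 / 2 * ∫ _ζ : sphere (0 : E) 1, (1 : ℝ) ∂(volume : Measure E).toSphere := by
  have : Nontrivial E := nontrivial_of_finrank_pos (R := ℝ) (by omega)
  obtain ⟨d, hd⟩ : ∃ d, finrank ℝ E = d + 1 := ⟨finrank ℝ E - 1, by omega⟩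
  set c := ∫ ζ : sphere (0 : E) 1, |⟪e, (ζ : E)⟫| ∂(volume : Measure E).toSphere
  set σ := ∫ _ζ : sphere (0 : E) 1, (1 : ℝ) ∂(volume : Measure E).toSphere
  have h1 := integral_angular_mul_radial (E := E) (fun x ↦ |⟪e, x⟫|) (fun r ↦ r * exp (-r ^ 2))
  have h2 := integral_angular_mul_radial (E := E) (fun _ ↦ 1) (fun r ↦ exp (-r ^ 2))
  have h3 : ∀ x : E, |⟪e, ‖x‖⁻¹ • x⟫| * (‖x‖ * exp (-‖x‖ ^ 2)) = |⟪e, x⟫| * exp (-‖x‖ ^ 2) := by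
    intro x
    rcases eq_or_ne x 0 with rfl | hx
    · simp
    · have := norm_pos_iff.2 hx
      rw [inner_smul_right, abs_mul, abs_of_pos (inv_pos.2 this)]
      field_simp
  simp_rw [h3, integral_abs_inner_mul_exp_neg_norm_sq he, ← mul_assoc, ← pow_succ, hd,
    Nat.add_sub_cancel] at h1
  simp_rw [one_mul, integral_exp_neg_norm_sq, hd, Nat.add_sub_cancel] at h2
  rw [integral_Ioi_pow_mul_exp_neg_sq] at h1 h2
  have hG := two_mul_Gamma_half_le (d + 1) (by omega)
  push_cast at hG h1 h2
  set G1 := Gamma (((d : ℝ) + 1) / 2)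
  have hG2 : 0 < Gamma (((d : ℝ) + 1 + 1) / 2) := Gamma_pos_of_pos (by positivity)
  set G2 := Gamma (((d : ℝ) + 1 + 1) / 2)
  have hσ : 0 ≤ σ := integral_nonneg fun _ ↦ zero_le_one
  have hπ : 0 < √π := sqrt_pos.2 pi_pos
  -- The two Gaussian integrals differ by one factor `√π`; eliminating the common power gives the
  -- exact mean `c/σ`.
  have h4 : √π * (c * G2) = σ * G1 := by
    rw [pow_succ] at h2
    linear_combination (-2 * √π) * h1 + 2 * h2
  have h5 : √π * (c * G2) ≤ √π * (1 / 2 * σ * G2) := by nlinarith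
  exact le_of_mul_le_mul_right (le_of_mul_le_mul_left h5 hπ) hG2

theorem integral_abs_inner_mul_radial_le (hE : 3 ≤ finrank ℝ E) {e : E} (he : ‖e‖ = 1)
    {f : ℝ → ℝ} (hf : ∀ r, 0 ≤ r → 0 ≤ f r) :
    ∫ x : E, |⟪e, x⟫| * f ‖x‖ ≤ 1 / 2 * ∫ x : E, ‖x‖ * f ‖x‖ := by
  have : Nontrivial E := nontrivial_of_finrank_pos (R := ℝ) (by omega)
  have h1 := integral_angular_mul_radial (E := E) (fun x ↦ |⟪e, x⟫|) (fun r ↦ r * f r)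
  have h2 := integral_angular_mul_radial (E := E) (fun _ ↦ 1) (fun r ↦ r * f r)
  have h3 : ∀ x : E, |⟪e, ‖x‖⁻¹ • x⟫| * (‖x‖ * f ‖x‖) = |⟪e, x⟫| * f ‖x‖ := by
    intro x
    rcases eq_or_ne x 0 with rfl | hx
    · simp
    · have := norm_pos_iff.2 hx
      rw [inner_smul_right, abs_mul, abs_of_pos (inv_pos.2 this)]
      field_simp
  simp_rw [h3] at h1
  simp_rw [one_mul] at h2
  rw [h1, h2, ← mul_assoc]
  refine mul_le_mul_of_nonneg_right (integral_toSphere_abs_inner_le hE he) ?_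
  refine setIntegral_nonneg measurableSet_Ioi fun r hr ↦ ?_
  have hr' : 0 ≤ r := le_of_lt hr
  exact mul_nonneg (pow_nonneg hr' _) (mul_nonneg hr' (hf r hr'))

end SphereAverage

/-! ### Sublevel sets of the squared norm, and calculus at the edge of a support. -/

section NormBalls

variable {E : Type*} [NormedAddCommGroup E]

theorem integrable_of_continuousOn_of_eq_zero [MeasurableSpace E] [BorelSpace E]
    {μ : Measure E} [IsFiniteMeasureOnCompacts μ] {K : Set E} {F : E → ℝ}
    (hK : IsCompact K) (hF : ContinuousOn F K) (h0 : ∀ x ∉ K, F x = 0) : Integrable F μ := by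
  rw [← integrableOn_iff_integrable_of_support_subset (s := K)
    fun x hx ↦ by_contra fun h ↦ hx (h0 x h)]
  exact hF.integrableOn_compact hK

theorem norm_sq_lt_one_of_mem_ball {x : E} (hx : x ∈ ball (0 : E) 1) : ‖x‖ ^ 2 < 1 := by
  rw [mem_ball_zero_iff] at hx
  nlinarith [norm_nonneg x]

theorem setOf_norm_sq_le_eq {b : ℝ} (hb : 0 ≤ b) :
    {x : E | ‖x‖ ^ 2 ≤ b} = closedBall 0 (√b) := by
  ext x
  simp [Real.le_sqrt (norm_nonneg x) hb]

theorem isCompact_setOf_norm_sq_le [ProperSpace E] {b : ℝ} :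
    IsCompact {x : E | ‖x‖ ^ 2 ≤ b} := by
  rcases le_or_gt 0 b with hb | hb
  · rw [setOf_norm_sq_le_eq hb]
    exact isCompact_closedBall _ _
  · convert isCompact_empty
    ext x
    simp; nlinarith [norm_nonneg x]

theorem setOf_norm_sq_le_subset_ball {b : ℝ} (hb : b < 1) :
    {x : E | ‖x‖ ^ 2 ≤ b} ⊆ ball 0 1 := by
  intro x hx
  have hx : ‖x‖ ^ 2 ≤ b := hx
  rw [mem_ball_zero_iff]
  nlinarith [norm_nonneg x]

theorem one_sub_mul_norm_sq_pos {τ : ℝ} (hτ1 : τ ≤ 1) {x : E} (hx : x ∈ ball (0 : E) 1) :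
    0 < 1 - τ * ‖x‖ ^ 2 := by
  have := norm_sq_lt_one_of_mem_ball hx
  nlinarith [sq_nonneg ‖x‖]

end NormBalls

theorem deriv_eq_zero_of_eq_zero_of_lt {γ : ℝ → ℝ} {b s : ℝ} (hγ : ∀ s, b ≤ s → γ s = 0)
    (hs : b < s) : deriv γ s = 0 := by
  have : γ =ᶠ[nhds s] fun _ ↦ 0 := by
    filter_upwards [lt_mem_nhds hs] with t ht using hγ t ht.le
  rw [this.deriv_eq]; simp

theorem deriv_eq_zero_of_eq_zero_of_le {γ : ℝ → ℝ} {b s : ℝ} (hγ1 : ContDiff ℝ 1 γ)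
    (hγ : ∀ s, b ≤ s → γ s = 0) (hs : b ≤ s) : deriv γ s = 0 := by
  have hcl : IsClosed {s | deriv γ s = 0} :=
    isClosed_eq (hγ1.continuous_deriv le_rfl) continuous_const
  have : Ici b ⊆ {s | deriv γ s = 0} := by
    rw [← closure_Ioi]
    exact closure_minimal (fun s hs ↦ deriv_eq_zero_of_eq_zero_of_lt hγ hs) hcl
  exact this hs

/-- Off its closed support a function is locally zero. This makes products with factors regular only
on an open set globally regular. -/
theorem contDiff_of_contDiffAt_tsupport {E F : Type*} [NormedAddCommGroup E] [NormedSpace ℝ E]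
    [NormedAddCommGroup F] [NormedSpace ℝ F] {f : E → F} {k : WithTop ℕ∞}
    (hf : ∀ x ∈ tsupport f, ContDiffAt ℝ k f x) : ContDiff ℝ k f := by
  refine contDiff_iff_contDiffAt.2 fun x ↦ ?_
  by_cases hx : x ∈ tsupport f
  · exact hf x hx
  · exact contDiffAt_const.congr_of_eventuallyEq (notMem_tsupport_iff_eventuallyEq.1 hx)

/-! ### Compactly supported test functions and integration by parts. -/

section TestFunctions

variable {E : Type*} [NormedAddCommGroup E] [InnerProductSpace ℝ E] {U : Set E}

/-- Continuously differentiable functions whose support is a compact subset of `U`. -/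
structure IsTestFunction (U : Set E) (w : E → ℝ) : Prop where
  contDiff : ContDiff ℝ 1 w
  hasCompactSupport : HasCompactSupport w
  tsupport_subset : tsupport w ⊆ U

theorem IsTestFunction.mul_left {f w : E → ℝ} (hw : IsTestFunction U w) (hU : IsOpen U)
    (hf : ContDiffOn ℝ 1 f U) : IsTestFunction U (fun x ↦ f x * w x) where
  contDiff := by
    refine contDiff_of_contDiffAt_tsupport fun x hx ↦ ?_
    have hx' : x ∈ U := hw.tsupport_subset (tsupport_mul_subset_right hx)
    exact (hf.contDiffAt (hU.mem_nhds hx')).mul hw.contDiff.contDiffAt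
  hasCompactSupport := hw.hasCompactSupport.mul_left
  tsupport_subset := (tsupport_mul_subset_right).trans hw.tsupport_subset

theorem fderiv_eq_zero_of_notMem_tsupport {w : E → ℝ} {x : E} (hx : x ∉ tsupport w) :
    fderiv ℝ w x = 0 :=
  image_eq_zero_of_notMem_tsupport fun h ↦ hx (tsupport_fderiv_subset ℝ h)

theorem IsTestFunction.integrable_mul [MeasurableSpace E] [BorelSpace E]
    {μ : Measure E} [IsFiniteMeasureOnCompacts μ] {w f : E → ℝ} (hw : IsTestFunction U w)
    (hf : ContinuousOn f U) : Integrable (fun x ↦ f x * w x) μ :=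
  integrable_of_continuousOn_of_eq_zero hw.hasCompactSupport
    ((hf.mono hw.tsupport_subset).mul hw.contDiff.continuous.continuousOn)
    fun x hx ↦ by simp [image_eq_zero_of_notMem_tsupport hx]

theorem IsTestFunction.continuous_fderiv_apply {w : E → ℝ} (hw : IsTestFunction U w) {v : E → E}
    (hv : Continuous v) : Continuous fun x ↦ fderiv ℝ w x (v x) :=
  (hw.contDiff.continuous_fderiv one_ne_zero).clm_apply hv

theorem IsTestFunction.integrable_fderiv_apply [MeasurableSpace E] [BorelSpace E]
    {μ : Measure E} [IsFiniteMeasureOnCompacts μ] {w : E → ℝ} (hw : IsTestFunction U w)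
    {v : E → E} (hv : Continuous v) : Integrable (fun x ↦ fderiv ℝ w x (v x)) μ :=
  integrable_of_continuousOn_of_eq_zero hw.hasCompactSupport
    (hw.continuous_fderiv_apply hv).continuousOn
    fun x hx ↦ by simp [fderiv_eq_zero_of_notMem_tsupport hx]

variable [FiniteDimensional ℝ E] [MeasurableSpace E] [BorelSpace E]

theorem IsTestFunction.integral_fderiv_apply_const {w : E → ℝ} (hw : IsTestFunction U w) (v : E) :
    ∫ x, fderiv ℝ w x v = 0 := by
  have h := integral_mul_fderiv_eq_neg_fderiv_mul_of_integrable (μ := (volume : Measure E))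
    (f := fun _ ↦ (1 : ℝ)) (g := w) (v := v) (by simp)
    (by simpa using hw.integrable_fderiv_apply continuous_const)
    (by simpa using hw.contDiff.continuous.integrable_of_hasCompactSupport hw.hasCompactSupport)
    (by simp) (fun x _ ↦ hw.contDiff.differentiable one_ne_zero x)
  simpa using h

/-- The integral of the divergence of `w • id` vanishes. -/
theorem IsTestFunction.integral_fderiv_apply_self {w : E → ℝ} (hw : IsTestFunction U w) :
    ∫ x, (fderiv ℝ w x x + finrank ℝ E * w x) = 0 := by
  let b := stdOrthonormalBasis ℝ E
  have hb : ∀ i, IsTestFunction U (fun x ↦ ⟪b i, x⟫ * w x) := fun i ↦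
    { contDiff := (contDiff_const.inner ℝ contDiff_id).mul hw.contDiff
      hasCompactSupport := hw.hasCompactSupport.mul_left
      tsupport_subset := (tsupport_mul_subset_right).trans hw.tsupport_subset }
  have h : ∀ x, fderiv ℝ w x x + finrank ℝ E * w x =
      ∑ i, fderiv ℝ (fun x ↦ ⟪b i, x⟫ * w x) x (b i) := by
    intro x
    have h1 : ∀ i, fderiv ℝ (fun x ↦ ⟪b i, x⟫ * w x) x (b i) =
        fderiv ℝ w x (⟪b i, x⟫ • b i) + w x := by
      intro i
      have h2 : HasFDerivAt (fun x ↦ ⟪b i, x⟫) (innerSL ℝ (b i)) x :=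
        (innerSL ℝ (b i)).hasFDerivAt
      rw [(h2.fun_mul (hw.contDiff.differentiable one_ne_zero x).hasFDerivAt).fderiv]
      simp
    simp_rw [h1, Finset.sum_add_distrib, ← map_sum, b.sum_repr']
    simp
  simp_rw [h]
  rw [integral_finsetSum _ fun i _ ↦ (hb i).integrable_fderiv_apply continuous_const]
  exact Finset.sum_eq_zero fun i _ ↦ (hb i).integral_fderiv_apply_const _

end TestFunctions

/-! ### Divergence theorem for fields with radial coefficients. -/

section RadialFields

variable {E : Type*} [NormedAddCommGroup E] [InnerProductSpace ℝ E]

theorem hasFDerivAt_comp_norm_sq {g : ℝ → ℝ} {g' : ℝ} {x : E} (hg : HasDerivAt g g' (‖x‖ ^ 2)) :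
    HasFDerivAt (fun y : E ↦ g (‖y‖ ^ 2)) ((2 * g') • innerSL ℝ x) x := by
  have h := hg.comp_hasFDerivAt x (HasFDerivAt.norm_sq (hasFDerivAt_id (𝕜 := ℝ) x))
  refine h.congr_fderiv ?_
  ext v
  simp; ring

theorem isTestFunction_comp_norm_sq [FiniteDimensional ℝ E] {g : ℝ → ℝ} {b : ℝ} (hb : b < 1)
    (hg : ContDiff ℝ 1 g) (h0 : ∀ s, b ≤ s → g s = 0) :
    IsTestFunction (ball (0 : E) 1) fun x ↦ g (‖x‖ ^ 2) := by
  have hsub : tsupport (fun x : E ↦ g (‖x‖ ^ 2)) ⊆ {x : E | ‖x‖ ^ 2 ≤ b} :=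
    closure_minimal (fun x hx ↦ le_of_not_ge fun h ↦ hx (h0 _ h))
      isCompact_setOf_norm_sq_le.isClosed
  exact ⟨hg.comp (contDiff_norm_sq ℝ), isCompact_setOf_norm_sq_le.of_isClosed_subset
    (isClosed_tsupport _) hsub, hsub.trans (setOf_norm_sq_le_subset_ball hb)⟩

variable [FiniteDimensional ℝ E] [MeasurableSpace E] [BorelSpace E]

/-- The divergence theorem for the vector field `α(|x|²) e + ⟪e, x⟫ β(|x|²) x` and a function `u`
on the unit ball. -/
theorem integral_fderiv_apply_radial_field {u : E → ℝ} (hu : ContDiffOn ℝ 1 u (ball 0 1))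
    {α β : ℝ → ℝ} {b : ℝ} (hb : b < 1) (hα : ContDiff ℝ 1 α) (hβ : ContDiff ℝ 1 β)
    (hα0 : ∀ s, b ≤ s → α s = 0) (hβ0 : ∀ s, b ≤ s → β s = 0) (e : E) :
    ∫ x, fderiv ℝ u x (α (‖x‖ ^ 2) • e + (⟪e, x⟫ * β (‖x‖ ^ 2)) • x) =
      -∫ x, u x * (⟪e, x⟫ * (2 * deriv α (‖x‖ ^ 2) + 2 * ‖x‖ ^ 2 * deriv β (‖x‖ ^ 2)
        + (finrank ℝ E + 1) * β (‖x‖ ^ 2))) := by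
  have hA := isTestFunction_comp_norm_sq (E := E) hb hα hα0
  have hB0 := isTestFunction_comp_norm_sq (E := E) hb hβ hβ0
  have hB := hB0.mul_left isOpen_ball
    (contDiff_const.inner ℝ contDiff_id : ContDiff ℝ 1 fun x ↦ ⟪e, x⟫).contDiffOn
  have huA := hA.mul_left isOpen_ball hu
  have huB := hB.mul_left isOpen_ball hu
  have h1 := huA.integral_fderiv_apply_const e
  have h2 := huB.integral_fderiv_apply_self
  have i1 := huA.integrable_fderiv_apply (μ := volume) (continuous_const (y := e))
  have i2 : Integrable (fun x ↦ fderiv ℝ (fun x ↦ u x * (⟪e, x⟫ * β (‖x‖ ^ 2))) x x +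
      finrank ℝ E * (u x * (⟪e, x⟫ * β (‖x‖ ^ 2)))) volume :=
    (huB.integrable_fderiv_apply continuous_id).add
      ((huB.contDiff.continuous.integrable_of_hasCompactSupport huB.hasCompactSupport).const_mul _)
  have hcont : Continuous fun x : E ↦ ⟪e, x⟫ * (2 * deriv α (‖x‖ ^ 2) +
      2 * ‖x‖ ^ 2 * deriv β (‖x‖ ^ 2) + (finrank ℝ E + 1) * β (‖x‖ ^ 2)) := by
    have := hα.continuous_deriv le_rfl
    have := hβ.continuous_deriv le_rfl
    have := hβ.continuous
    fun_prop
  have i3 : Integrable (fun x : E ↦ u x * (⟪e, x⟫ * (2 * deriv α (‖x‖ ^ 2) +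
      2 * ‖x‖ ^ 2 * deriv β (‖x‖ ^ 2) + (finrank ℝ E + 1) * β (‖x‖ ^ 2)))) volume := by
    refine integrable_of_continuousOn_of_eq_zero (K := {x : E | ‖x‖ ^ 2 ≤ b})
      isCompact_setOf_norm_sq_le
      ((hu.continuousOn.mono (setOf_norm_sq_le_subset_ball hb)).mul hcont.continuousOn) ?_
    intro x hx
    have hx' : b < ‖x‖ ^ 2 := not_le.1 hx
    simp [deriv_eq_zero_of_eq_zero_of_lt hα0 hx', deriv_eq_zero_of_eq_zero_of_lt hβ0 hx', hβ0 _ hx'.le]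
  rw [eq_neg_iff_add_eq_zero]
  -- The product rule, with the first two terms total divergences. Outside the ball `u` is
  -- arbitrary, but every coefficient vanishes there.
  have key : ∀ x, fderiv ℝ u x (α (‖x‖ ^ 2) • e + (⟪e, x⟫ * β (‖x‖ ^ 2)) • x) =
      fderiv ℝ (fun x ↦ u x * α (‖x‖ ^ 2)) x e +
      (fderiv ℝ (fun x ↦ u x * (⟪e, x⟫ * β (‖x‖ ^ 2))) x x +
        finrank ℝ E * (u x * (⟪e, x⟫ * β (‖x‖ ^ 2)))) -
      u x * (⟪e, x⟫ * (2 * deriv α (‖x‖ ^ 2) +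
      2 * ‖x‖ ^ 2 * deriv β (‖x‖ ^ 2) + (finrank ℝ E + 1) * β (‖x‖ ^ 2))) := by
    intro x
    by_cases hx : x ∈ ball (0 : E) 1
    · have hux := ((hu.contDiffAt (isOpen_ball.mem_nhds hx)).differentiableAt
        one_ne_zero).hasFDerivAt
      have ha := hasFDerivAt_comp_norm_sq (x := x)
        (hα.differentiable one_ne_zero (‖x‖ ^ 2)).hasDerivAt
      have hb' := hasFDerivAt_comp_norm_sq (x := x)
        (hβ.differentiable one_ne_zero (‖x‖ ^ 2)).hasDerivAt
      have he : HasFDerivAt (fun x ↦ ⟪e, x⟫) (innerSL ℝ e) x := (innerSL ℝ e).hasFDerivAt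
      rw [(hux.fun_mul ha).fderiv, (hux.fun_mul (he.fun_mul hb')).fderiv]
      simp only [map_add, map_smul, add_apply, smul_apply, coe_innerSL_apply, smul_eq_mul,
        real_inner_self_eq_norm_sq, real_inner_comm x e]
      ring
    · have hx' : b < ‖x‖ ^ 2 :=
        not_le.1 fun h ↦ hx (setOf_norm_sq_le_subset_ball hb h)
      have hA' : x ∉ tsupport fun x ↦ u x * α (‖x‖ ^ 2) := fun h ↦ hx (huA.tsupport_subset h)
      have hB' : x ∉ tsupport fun x ↦ u x * (⟪e, x⟫ * β (‖x‖ ^ 2)) :=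
        fun h ↦ hx (huB.tsupport_subset h)
      rw [fderiv_eq_zero_of_notMem_tsupport hA', fderiv_eq_zero_of_notMem_tsupport hB']
      simp [deriv_eq_zero_of_eq_zero_of_lt hα0 hx', deriv_eq_zero_of_eq_zero_of_lt hβ0 hx', hβ0 _ hx'.le, hα0 _ hx'.le]
  simp_rw [key]
  rw [integral_sub (i1.fun_add i2) i3, integral_add i1 i2, h1, h2]
  ring

end RadialFields

/-! ### Mean value property by dilating the weight. -/

section MeanValue

variable {E : Type*} [NormedAddCommGroup E] [InnerProductSpace ℝ E] [FiniteDimensional ℝ E]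
  [MeasurableSpace E] [BorelSpace E]

theorem integral_mul_dilated_radial (V : E → ℝ) (g : ℝ → ℝ) {l : ℝ} (hl : 0 < l) :
    ∫ x, V x * (l ^ finrank ℝ E * g (l ^ 2 * ‖x‖ ^ 2)) = ∫ x, V (l⁻¹ • x) * g (‖x‖ ^ 2) := by
  have h := Measure.integral_comp_smul (volume : Measure E)
    (fun y ↦ V (l⁻¹ • y) * g (‖y‖ ^ 2)) l
  simp only [smul_smul, inv_mul_cancel₀ hl.ne', one_smul, norm_smul, mul_pow, norm_eq_abs, sq_abs,
    smul_eq_mul] at h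
  rw [abs_of_pos (by positivity), eq_inv_mul_iff_mul_eq₀ (by positivity),
    ← integral_const_mul] at h
  rw [← h]
  congr with x
  ring

/-- A function whose integral against the divergence of every radial multiple of the identity
vanishes has the mean value property with respect to radial weights. -/
theorem integral_mul_radial_eq_of_integral_mul_div_eq_zero {V : E → ℝ}
    (hV : ContinuousOn V (ball 0 1))
    (hdiv : ∀ (g : ℝ → ℝ) (b : ℝ), b < 1 → ContDiff ℝ 2 g → (∀ s, b ≤ s → g s = 0) →
      ∫ x, V x * (2 * ‖x‖ ^ 2 * deriv g (‖x‖ ^ 2) + finrank ℝ E * g (‖x‖ ^ 2)) = 0)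
    {g : ℝ → ℝ} {b : ℝ} (hb : b < 1) (hg : ContDiff ℝ 2 g) (hg0 : ∀ s, b ≤ s → g s = 0) :
    ∫ x, V x * g (‖x‖ ^ 2) = V 0 * ∫ x : E, g (‖x‖ ^ 2) := by
  -- The number `b` only bounds the support of `g` from above, so it may be raised.
  wlog hb0 : 0 < b generalizing b
  · exact this (b := 1 / 2) (by norm_num) (fun s hs ↦ hg0 s (by linarith)) (by norm_num)
  set d := finrank ℝ E
  -- The slack keeps the dilated weight supported in one compact set also for `l` slightly below
  -- `1`, so that `J` has a two-sided derivative at `l = 1`.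
  obtain ⟨b', hbb', hb'⟩ : ∃ b', b < b' ∧ b' < 1 := exists_between hb
  set K : Set E := {x | ‖x‖ ^ 2 ≤ b'}
  have hK : IsCompact K := isCompact_setOf_norm_sq_le
  have hVK : ContinuousOn V K := hV.mono (setOf_norm_sq_le_subset_ball hb')
  have hg1 : Continuous (deriv g) := hg.continuous_deriv one_le_two
  have hgc := hg.continuous
  have hgd : ∀ s, HasDerivAt g (deriv g s) s :=
    fun s ↦ (hg.differentiable two_ne_zero s).hasDerivAt
  have hg1z : ∀ s, b < s → deriv g s = 0 := fun s hs ↦ deriv_eq_zero_of_eq_zero_of_lt hg0 hs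
  let J : ℝ → ℝ := fun l ↦ ∫ x, V x * (l ^ d * g (l ^ 2 * ‖x‖ ^ 2))
  let G' : ℝ × E → ℝ := fun p ↦ d * p.1 ^ (d - 1) * g (p.1 ^ 2 * ‖p.2‖ ^ 2) +
    p.1 ^ d * (deriv g (p.1 ^ 2 * ‖p.2‖ ^ 2) * (2 * p.1 * ‖p.2‖ ^ 2))
  have hG'c : Continuous G' := by fun_prop
  have hlarge : ∀ l : ℝ, b / b' < l ^ 2 → ∀ x ∉ K, b < l ^ 2 * ‖x‖ ^ 2 := by
    intro l hl x hx
    have hx' : b' < ‖x‖ ^ 2 := not_le.1 hx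
    rw [div_lt_iff₀ (hb0.trans hbb')] at hl
    nlinarith [sq_nonneg l]
  have hone : ∀ l : ℝ, 1 ≤ l → b / b' < l ^ 2 := by
    intro l hl
    have : b / b' < 1 := (div_lt_one (hb0.trans hbb')).2 hbb'
    nlinarith
  have hint : ∀ l : ℝ, b / b' < l ^ 2 →
      Integrable (fun x ↦ V x * (l ^ d * g (l ^ 2 * ‖x‖ ^ 2))) := by
    intro l hl
    refine integrable_of_continuousOn_of_eq_zero hK (hVK.mul (by fun_prop)) fun x hx ↦ ?_
    simp [hg0 _ (hlarge l hl x hx).le]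
  have hderiv : ∀ l : ℝ, 1 ≤ l → HasDerivAt J 0 l := by
    intro l hl
    have hS : {y : ℝ | b / b' < y ^ 2} ∩ Icc (l - 1) (l + 1) ∈ nhds l :=
      Filter.inter_mem ((isOpen_lt continuous_const (continuous_pow 2)).mem_nhds (hone l hl))
        (Icc_mem_nhds (by linarith) (by linarith))
    obtain ⟨C, hC⟩ := (isCompact_Icc (a := l - 1) (b := l + 1)).prod hK
      |>.exists_bound_of_continuousOn ((hVK.comp continuousOn_snd fun _ hp ↦ hp.2).mul hG'c.continuousOn)
    have h := (hasDerivAt_integral_of_dominated_loc_of_deriv_le (μ := (volume : Measure E))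
      (F := fun l x ↦ V x * (l ^ d * g (l ^ 2 * ‖x‖ ^ 2))) (F' := fun l x ↦ V x * G' (l, x))
      (bound := K.indicator fun _ ↦ C) hS
      (by filter_upwards [hS] with y hy using (hint y hy.1).aestronglyMeasurable)
      (hint l (hone l hl))
      (integrable_of_continuousOn_of_eq_zero hK (hVK.mul (by fun_prop)) fun x hx ↦ by
        have := hlarge l (hone l hl) x hx
        simp [G', hg0 _ this.le, hg1z _ this]).aestronglyMeasurable
      (Filter.Eventually.of_forall fun x y hy ↦ by
        by_cases hx : x ∈ K
        · rw [indicator_of_mem hx]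
          exact hC (y, x) ⟨hy.2, hx⟩
        · have := hlarge y hy.1 x hx
          simp [G', hg0 _ this.le, hg1z _ this, hx])
      ((integrable_indicator_iff hK.measurableSet).2
        (integrableOn_const hK.measure_lt_top.ne))
      (Filter.Eventually.of_forall fun x y _ ↦ by
        have h1 : HasDerivAt (fun y : ℝ ↦ y ^ 2 * ‖x‖ ^ 2) (2 * y * ‖x‖ ^ 2) y := by
          simpa using (hasDerivAt_pow 2 y).mul_const (‖x‖ ^ 2)
        exact ((hasDerivAt_pow d y).fun_mul ((hgd _).comp y h1)).const_mul (V x))).2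
    have hl0 : 0 < l := by linarith
    have hzero := hdiv (fun s ↦ l ^ d * g (l ^ 2 * s)) b hb
      (contDiff_const.mul (hg.comp (contDiff_const.mul contDiff_id)))
      (fun s hs ↦ by
        rw [hg0 _ (hs.trans (le_mul_of_one_le_left (hb0.le.trans hs) (one_le_pow₀ hl))), mul_zero])
    have hd1 : ∀ s, deriv (fun s ↦ l ^ d * g (l ^ 2 * s)) s =
        l ^ d * (deriv g (l ^ 2 * s) * l ^ 2) := by
      intro s
      have h1 : HasDerivAt (fun s : ℝ ↦ l ^ 2 * s) (l ^ 2) s := by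
        simpa using (hasDerivAt_id s).const_mul (l ^ 2)
      exact (((hgd _).comp s h1).const_mul (l ^ d)).deriv
    have heq : ∫ x, V x * G' (l, x) = 0 := by
      -- The `l`-derivative of the dilated weight is `l⁻¹` times the divergence of that weight times
      -- the identity field, so `hdiv` makes `J` constant.
      have h2 : ∀ x, V x * G' (l, x) = l⁻¹ * (V x * (2 * ‖x‖ ^ 2 *
          deriv (fun s ↦ l ^ d * g (l ^ 2 * s)) (‖x‖ ^ 2) +
            d * (l ^ d * g (l ^ 2 * ‖x‖ ^ 2)))) := by
        intro x
        simp only [hd1, G']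
        rcases Nat.eq_zero_or_pos d with h0 | h0
        · rw [h0]; field_simp; ring
        · obtain ⟨k, hk⟩ : ∃ k, d = k + 1 := ⟨d - 1, by omega⟩
          rw [hk, Nat.add_sub_cancel]; field_simp; ring
      simp_rw [h2]
      rw [integral_const_mul, hzero, mul_zero]
    rwa [heq] at h
  have hconst : ∀ L : ℝ, 1 ≤ L → J L = J 1 := by
    intro L hL
    exact constant_of_has_deriv_right_zero
      (fun x hx ↦ (hderiv x hx.1).continuousAt.continuousWithinAt)
      (fun x hx ↦ (hderiv x hx.1).hasDerivWithinAt) L ⟨hL, le_rfl⟩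
  have hJ1 : J 1 = ∫ x, V x * g (‖x‖ ^ 2) := by simp [J]
  obtain ⟨C, hC⟩ := hK.exists_bound_of_continuousOn hVK
  have hscale : ∀ l : ℝ, 1 ≤ l → ∀ x ∈ K, l⁻¹ • x ∈ K := by
    intro l hl x hx
    have h1 : l⁻¹ ≤ 1 := inv_le_one_of_one_le₀ hl
    have h2 : 0 ≤ l⁻¹ := by positivity
    have hx' : ‖x‖ ^ 2 ≤ b' := hx
    change ‖l⁻¹ • x‖ ^ 2 ≤ b'
    rw [norm_smul, norm_eq_abs, abs_of_nonneg h2, mul_pow]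
    nlinarith [sq_nonneg ‖x‖, pow_le_one₀ h2 h1 (n := 2)]
  -- As `l → ∞` the dilated weights concentrate at the origin, where `V` is continuous.
  have hlim : Filter.Tendsto (fun l : ℝ ↦ ∫ x, V (l⁻¹ • x) * g (‖x‖ ^ 2)) Filter.atTop
      (nhds (∫ x : E, V 0 * g (‖x‖ ^ 2))) := by
    have hgK : ∀ x ∉ K, g (‖x‖ ^ 2) = 0 := fun x hx ↦ hg0 _ (hbb'.le.trans (not_le.1 hx).le)
    refine tendsto_integral_filter_of_dominated_convergence
      (fun x ↦ C * |g (‖x‖ ^ 2)|) ?_ ?_ ?_ ?_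
    · filter_upwards [Filter.eventually_ge_atTop 1] with l hl
      refine (integrable_of_continuousOn_of_eq_zero hK (ContinuousOn.mul ?_ (by fun_prop))
        fun x hx ↦ by simp [hgK x hx]).aestronglyMeasurable
      exact hVK.comp (by fun_prop) (hscale l hl)
    · filter_upwards [Filter.eventually_ge_atTop 1] with l hl
      refine Filter.Eventually.of_forall fun x ↦ ?_
      by_cases hx : x ∈ K
      · rw [norm_mul]
        exact mul_le_mul_of_nonneg_right (hC _ (hscale l hl x hx)) (abs_nonneg _)
      · simp [hgK x hx]
    · exact integrable_of_continuousOn_of_eq_zero hK (by fun_prop) fun x hx ↦ by simp [hgK x hx]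
    · refine Filter.Eventually.of_forall fun x ↦ Filter.Tendsto.mul_const _ ?_
      have h0 : ContinuousAt V 0 := hV.continuousAt (isOpen_ball.mem_nhds (by simp))
      refine h0.tendsto.comp ?_
      simpa using (tendsto_inv_atTop_zero (𝕜 := ℝ)).smul_const x
  have hlim' : Filter.Tendsto (fun l : ℝ ↦ ∫ x, V (l⁻¹ • x) * g (‖x‖ ^ 2)) Filter.atTop
      (nhds (∫ x, V x * g (‖x‖ ^ 2))) := by
    refine tendsto_const_nhds.congr' ?_
    filter_upwards [Filter.eventually_ge_atTop 1] with l hl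
    rw [← integral_mul_dilated_radial V g (by linarith), ← hJ1]
    exact (hconst l hl).symm
  rw [tendsto_nhds_unique hlim' hlim, integral_const_mul]

end MeanValue

/-! ### The weak equation and the derivative along translations. -/

section WeakSolutions

variable {E : Type*} [NormedAddCommGroup E] [InnerProductSpace ℝ E] [FiniteDimensional ℝ E]
  [MeasurableSpace E] [BorelSpace E]

/-- The weak form of `(1 - τ|x|²) Δu + 2τ(d - 2) x · ∇u = 0` on the unit ball of a `d`-dimensional
space. For `τ = 0` these are the harmonic functions, for `τ = 1` the hyperbolic harmonic ones. -/
def IsWeaklyHarmonic (τ : ℝ) (u : E → ℝ) : Prop :=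
  ∀ w, IsTestFunction (ball 0 1) w →
    ∫ x, ((1 - τ * ‖x‖ ^ 2) ^ (finrank ℝ E - 2))⁻¹ * fderiv ℝ u x (gradient w x) = 0

/-- The derivative of `u` along the infinitesimal translation in direction `e`. -/
noncomputable def translationDeriv (τ : ℝ) (u : E → ℝ) (e x : E) : ℝ :=
  fderiv ℝ u x ((1 + τ * ‖x‖ ^ 2) • e - (2 * τ * ⟪e, x⟫) • x)

omit [FiniteDimensional ℝ E] [MeasurableSpace E] [BorelSpace E] in
theorem continuousOn_fderiv_apply {u : E → ℝ} (hu : ContDiffOn ℝ 1 u (ball 0 1)) {X : E → E}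
    (hX : Continuous X) : ContinuousOn (fun x ↦ fderiv ℝ u x (X x)) (ball 0 1) :=
  (hu.continuousOn_fderiv_of_isOpen isOpen_ball le_rfl).clm_apply hX.continuousOn

omit [FiniteDimensional ℝ E] [MeasurableSpace E] [BorelSpace E] in
theorem continuousOn_translationDeriv {u : E → ℝ} (hu : ContDiffOn ℝ 1 u (ball 0 1)) (τ : ℝ)
    (e : E) : ContinuousOn (translationDeriv τ u e) (ball 0 1) :=
  continuousOn_fderiv_apply hu (by fun_prop)

/-- Up to a divergence-free field, the divergence of `g(|x|²)x` times the translation field is the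
weighted gradient of the test function `⟪e,x⟫ (1 - τ|x|²)^(d-1) g(|x|²)`. The first integrates to
zero against `∇u` by the divergence theorem, the second by the weak equation. -/
theorem IsWeaklyHarmonic.integral_translationDeriv_mul_div {τ : ℝ} (hτ1 : τ ≤ 1)
    (hE : 2 ≤ finrank ℝ E) {u : E → ℝ} (hu : ContDiffOn ℝ 1 u (ball 0 1))
    (hw : IsWeaklyHarmonic τ u) (e : E) {g : ℝ → ℝ} {b : ℝ} (hb : b < 1) (hg : ContDiff ℝ 2 g)
    (hg0 : ∀ s, b ≤ s → g s = 0) :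
    ∫ x, translationDeriv τ u e x *
      (2 * ‖x‖ ^ 2 * deriv g (‖x‖ ^ 2) + finrank ℝ E * g (‖x‖ ^ 2)) = 0 := by
  obtain ⟨k, hk⟩ : ∃ k, finrank ℝ E = k + 2 := ⟨finrank ℝ E - 2, by omega⟩
  have hk' : (finrank ℝ E : ℝ) = k + 2 := by rw [hk]; push_cast; ring
  have hg1 : ContDiff ℝ 1 (deriv g) := (contDiff_succ_iff_deriv (n := 1).1 hg).2.2
  have hgC : ContDiff ℝ 1 g := hg.of_le one_le_two
  have hgd : ∀ s, HasDerivAt g (deriv g s) s :=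
    fun s ↦ (hg.differentiable two_ne_zero s).hasDerivAt
  have hgdd : ∀ s, HasDerivAt (deriv g) (deriv (deriv g) s) s :=
    fun s ↦ (hg1.differentiable one_ne_zero s).hasDerivAt
  have hg1z : ∀ s, b < s → deriv g s = 0 := fun s hs ↦ deriv_eq_zero_of_eq_zero_of_lt hg0 hs
  obtain ⟨b', hbb', hb'⟩ : ∃ b', b < b' ∧ b' < 1 := exists_between hb
  -- the test function and its weighted gradient
  let G : ℝ → ℝ := fun s ↦ (1 - τ * s) ^ (k + 1) * g s
  have hG : ContDiff ℝ 1 G :=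
    ((contDiff_const.sub (contDiff_const.mul contDiff_id)).pow _).mul hgC
  have hGd : ∀ s, HasDerivAt G (-(τ * (k + 1)) * (1 - τ * s) ^ k * g s +
      (1 - τ * s) ^ (k + 1) * deriv g s) s := by
    intro s
    have h1 : HasDerivAt (fun s : ℝ ↦ 1 - τ * s) (-τ) s := by
      simpa using ((hasDerivAt_id s).const_mul τ).const_sub 1
    have h2 := (h1.fun_pow (k + 1)).fun_mul (hgd s)
    refine h2.congr_deriv ?_
    push_cast [Nat.add_sub_cancel]
    ring
  have htest : IsTestFunction (ball (0 : E) 1) fun x ↦ ⟪e, x⟫ * G (‖x‖ ^ 2) :=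
    (isTestFunction_comp_norm_sq hb hG fun s hs ↦ by simp [G, hg0 s hs]).mul_left isOpen_ball
      (contDiff_const.inner ℝ contDiff_id : ContDiff ℝ 1 fun x ↦ ⟪e, x⟫).contDiffOn
  -- Coefficients of the weighted gradient minus the divergence factor times the translation field;
  -- `hdiv` checks that this difference is divergence-free.
  let α : ℝ → ℝ := fun s ↦ (1 - τ * s) * g s -
    (1 + τ * s) * (2 * s * deriv g s + (k + 2) * g s)
  let β : ℝ → ℝ := fun s ↦ 2 * ((1 - τ * s) * deriv g s - τ * (k + 1) * g s) +
    2 * τ * (2 * s * deriv g s + (k + 2) * g s)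
  have hα : ContDiff ℝ 1 α := by fun_prop
  have hβ : ContDiff ℝ 1 β := by fun_prop
  have h1 := hw _ htest
  have h2 := integral_fderiv_apply_radial_field hu hb' hα hβ
    (fun s hs ↦ by simp [α, hg0 s (hbb'.le.trans hs), hg1z s (hbb'.trans_le hs)])
    (fun s hs ↦ by simp [β, hg0 s (hbb'.le.trans hs), hg1z s (hbb'.trans_le hs)]) e
  have hdiv : ∀ s, 2 * deriv α s + 2 * s * deriv β s + (finrank ℝ E + 1) * β s = 0 := by
    intro s
    have hid := hasDerivAt_id' s
    have hq := ((hid.const_mul 2).fun_mul (hgdd s)).fun_add ((hgd s).const_mul ((k : ℝ) + 2))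
    have hα' := (((hid.const_mul τ).const_sub 1).fun_mul (hgd s)).fun_sub
      (((hid.const_mul τ).const_add 1).fun_mul hq)
    have hβ' := (((((hid.const_mul τ).const_sub 1).fun_mul (hgdd s)).fun_sub
      ((hgd s).const_mul (τ * (k + 1)))).const_mul 2).fun_add (hq.const_mul (2 * τ))
    rw [hα'.deriv, hβ'.deriv, hk']
    simp only [β]
    ring
  simp_rw [hdiv, mul_zero, integral_zero, neg_zero] at h2
  have hsupp : ∀ x : E, x ∉ ball (0 : E) 1 → b < ‖x‖ ^ 2 := fun x hx ↦
    not_le.1 fun h ↦ hx (setOf_norm_sq_le_subset_ball hb h)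
  have hptw : ∀ x, translationDeriv τ u e x *
      (2 * ‖x‖ ^ 2 * deriv g (‖x‖ ^ 2) + finrank ℝ E * g (‖x‖ ^ 2)) =
      ((1 - τ * ‖x‖ ^ 2) ^ (finrank ℝ E - 2))⁻¹ *
        fderiv ℝ u x (gradient (fun x ↦ ⟪e, x⟫ * G (‖x‖ ^ 2)) x) -
      fderiv ℝ u x (α (‖x‖ ^ 2) • e + (⟪e, x⟫ * β (‖x‖ ^ 2)) • x) := by
    intro x
    by_cases hx : x ∈ ball (0 : E) 1
    · have hpos := one_sub_mul_norm_sq_pos hτ1 hx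
      have he : HasFDerivAt (fun x ↦ ⟪e, x⟫) (innerSL ℝ e) x := (innerSL ℝ e).hasFDerivAt
      have hgrad : gradient (fun x ↦ ⟪e, x⟫ * G (‖x‖ ^ 2)) x = G (‖x‖ ^ 2) • e +
          (⟪e, x⟫ * (2 * (-(τ * (k + 1)) * (1 - τ * ‖x‖ ^ 2) ^ k * g (‖x‖ ^ 2) +
            (1 - τ * ‖x‖ ^ 2) ^ (k + 1) * deriv g (‖x‖ ^ 2)))) • x := by
        refine HasGradientAt.gradient ?_
        rw [hasGradientAt_iff_hasFDerivAt]
        refine (he.fun_mul (hasFDerivAt_comp_norm_sq (hGd _))).congr_fderiv ?_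
        ext v
        simp
        ring
      rw [hgrad, hk', hk, Nat.add_sub_cancel, translationDeriv]
      simp only [map_add, map_sub, map_smul, smul_eq_mul, G, α, β]
      field_simp
      ring
    · have hx' := hsupp x hx
      have hx2 : x ∉ tsupport fun x : E ↦ ⟪e, x⟫ * G (‖x‖ ^ 2) :=
        fun h ↦ hx (htest.tsupport_subset h)
      simp [gradient, fderiv_eq_zero_of_notMem_tsupport hx2, hg0 _ hx'.le, hg1z _ hx', α, β]
  have hK : IsCompact {x : E | ‖x‖ ^ 2 ≤ b} := isCompact_setOf_norm_sq_le
  have hKs := setOf_norm_sq_le_subset_ball (E := E) hb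
  have hgc := hg.continuous
  have hg1c := hg1.continuous
  have hgradc : Integrable (fun x ↦ translationDeriv τ u e x *
      (2 * ‖x‖ ^ 2 * deriv g (‖x‖ ^ 2) + finrank ℝ E * g (‖x‖ ^ 2))) volume := by
    refine integrable_of_continuousOn_of_eq_zero hK
      (((continuousOn_translationDeriv hu τ e).mono hKs).mul (by fun_prop)) fun x hx ↦ ?_
    have hx' : b < ‖x‖ ^ 2 := not_le.1 hx
    simp [hg0 _ hx'.le, hg1z _ hx']
  have hfield : Integrable (fun x ↦
      fderiv ℝ u x (α (‖x‖ ^ 2) • e + (⟪e, x⟫ * β (‖x‖ ^ 2)) • x)) volume := by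
    refine integrable_of_continuousOn_of_eq_zero hK
      ((continuousOn_fderiv_apply hu (by fun_prop)).mono hKs) fun x hx ↦ ?_
    have hx' : b < ‖x‖ ^ 2 := not_le.1 hx
    simp [hg0 _ hx'.le, hg1z _ hx', α, β]
  have h3 : ∫ x, (translationDeriv τ u e x *
      (2 * ‖x‖ ^ 2 * deriv g (‖x‖ ^ 2) + finrank ℝ E * g (‖x‖ ^ 2)) +
      fderiv ℝ u x (α (‖x‖ ^ 2) • e + (⟪e, x⟫ * β (‖x‖ ^ 2)) • x)) = 0 := by
    rw [← h1]
    congr with x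
    rw [hptw x]; ring
  rwa [integral_add hgradc hfield, h2, add_zero] at h3

end WeakSolutions

/-! ### Gradient estimate at the centre. -/

section GradientBound

variable {E : Type*} [NormedAddCommGroup E] [InnerProductSpace ℝ E] [FiniteDimensional ℝ E]
  [MeasurableSpace E] [BorelSpace E]

/-- A smooth decreasing cutoff. -/
theorem exists_smooth_antitone_cutoff {a b : ℝ} (hab : a < b) :
    ∃ q : ℝ → ℝ, (∀ k : ℕ, ContDiff ℝ k q) ∧ (∀ s, 0 ≤ q s) ∧ (∀ s, s ≤ a → q s = 1) ∧
      (∀ s, b ≤ s → q s = 0) ∧ ∀ s, deriv q s ≤ 0 := by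
  have hba : 0 < b - a := sub_pos.2 hab
  refine ⟨fun s ↦ smoothTransition ((b - s) / (b - a)), fun k ↦ ?_, fun s ↦ smoothTransition.nonneg _,
    fun s hs ↦ smoothTransition.one_of_one_le ((one_le_div hba).2 (by linarith)),
    fun s hs ↦ smoothTransition.zero_of_nonpos
      (div_nonpos_of_nonpos_of_nonneg (by linarith) hba.le), fun s ↦ ?_⟩
  · exact (smoothTransition.contDiff (n := k)).comp
      ((contDiff_const.sub contDiff_id).div_const _)
  · refine Antitone.deriv_nonpos fun s t hst ↦ smoothTransition.monotone ?_
    gcongr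

/-- The cutoff vanishes before `1 - τs` can reach zero. -/
theorem contDiff_mul_inv_pow {τ : ℝ} (hτ0 : 0 ≤ τ) (hτ1 : τ ≤ 1) {q : ℝ → ℝ} {b : ℝ} (hb : b < 1)
    {k : WithTop ℕ∞} (hq : ContDiff ℝ k q) (hq0 : ∀ s, b ≤ s → q s = 0) (j : ℕ) :
    ContDiff ℝ k fun s ↦ q s * ((1 - τ * s) ^ j)⁻¹ := by
  refine contDiff_of_contDiffAt_tsupport fun s hs ↦ hq.contDiffAt.mul ?_
  have hs' : s ≤ b := (closure_minimal (t := Iic b) (fun s hs ↦ by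
    by_contra h
    exact hs (by simp [hq0 s (not_le.1 h).le])) isClosed_Iic) hs
  refine ContDiffAt.inv (by fun_prop) (pow_ne_zero _ ?_)
  rcases le_or_gt 0 s with h | h <;> nlinarith

/-- The cutoff equals `1` on the ball of radius `R`, so only the shell outside it enters the
boundary term. The factor `R` is the price of replacing `|x|` by `|x|²` on that shell. -/
theorem IsWeaklyHarmonic.abs_fderiv_zero_mul_le {τ : ℝ} (hτ0 : 0 ≤ τ) (hτ1 : τ ≤ 1)
    (hE : 3 ≤ finrank ℝ E) {u : E → ℝ} (hu : ContDiffOn ℝ 1 u (ball 0 1))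
    (hw : IsWeaklyHarmonic τ u) {M : ℝ} (hM : ∀ x ∈ ball 0 1, |u x| ≤ M) {e : E} (he : ‖e‖ = 1)
    {R : ℝ} (hR0 : 0 < R) (hR1 : R < 1) :
    |fderiv ℝ u 0 e| * R ≤ (finrank ℝ E + τ * (finrank ℝ E - 2)) / 2 * M := by
  obtain ⟨k, hk⟩ : ∃ k, finrank ℝ E = k + 1 := ⟨finrank ℝ E - 1, by omega⟩
  have hk' : (finrank ℝ E : ℝ) = k + 1 := by rw [hk]; push_cast; ring
  have hM0 : 0 ≤ M := (abs_nonneg _).trans (hM 0 (by simp))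
  obtain ⟨b, hRb, hb⟩ : ∃ b, R ^ 2 < b ∧ b < 1 := exists_between (by nlinarith)
  have hb0 : 0 < b := by nlinarith
  obtain ⟨q, hqs, hqn, hq1, hq0, hqd⟩ := exists_smooth_antitone_cutoff hRb
  have hqD : ContDiff ℝ 1 (deriv q) := (contDiff_succ_iff_deriv (n := 1).1 (hqs 2)).2.2
  have hqd0 : ∀ s, b ≤ s → deriv q s = 0 :=
    fun s hs ↦ deriv_eq_zero_of_eq_zero_of_le (hqs 1) hq0 hs
  have hqd1 : ∀ s, s < R ^ 2 → deriv q s = 0 := by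
    intro s hs
    have : q =ᶠ[nhds s] fun _ ↦ 1 := by
      filter_upwards [gt_mem_nhds hs] with t ht using hq1 t ht.le
    rw [this.deriv_eq]; simp
  have hqh : ∀ s, HasDerivAt q (deriv q s) s :=
    fun s ↦ ((hqs 2).differentiable two_ne_zero s).hasDerivAt
  have hP : ∀ s, s < b → 0 < 1 - τ * s := fun s hs ↦ by
    rcases le_or_gt 0 s with h | h <;> nlinarith
  have hPd : ∀ s, HasDerivAt (fun s : ℝ ↦ 1 - τ * s) (-τ) s := fun s ↦ by
    simpa using ((hasDerivAt_id' s).const_mul τ).const_sub 1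
  have hinv : ∀ j : ℕ, ∀ s, s < b → HasDerivAt (fun s ↦ q s * ((1 - τ * s) ^ j)⁻¹)
      (deriv q s * ((1 - τ * s) ^ j)⁻¹ + j * τ * (q s * ((1 - τ * s) ^ (j + 1))⁻¹)) s := by
    intro j s hs
    have hne := (hP s hs).ne'
    refine ((hqh s).fun_mul (((hPd s).fun_pow j).fun_inv (pow_ne_zero _ hne))).congr_deriv ?_
    rcases j with _ | j
    · simp
    · rw [Nat.add_sub_cancel]; field_simp; ring
  -- The exponent `k + 1 = d` gives the volume density preserved by the translation field, so the
  -- divergence of `g` times that field involves only `q'`, that is, `F`. The exponent `d - 1` in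
  -- `f` makes `-F` the part of `f'` that comes from `q'`.
  let g : ℝ → ℝ := fun s ↦ q s * ((1 - τ * s) ^ (k + 1))⁻¹
  let f : ℝ → ℝ := fun s ↦ q s * ((1 - τ * s) ^ k)⁻¹
  let F : ℝ → ℝ := fun s ↦ -(deriv q s) * ((1 - τ * s) ^ k)⁻¹
  have hg : ContDiff ℝ 2 g := contDiff_mul_inv_pow hτ0 hτ1 hb (hqs 2) hq0 _
  have hf : ContDiff ℝ 1 f := contDiff_mul_inv_pow hτ0 hτ1 hb (hqs 1) hq0 _
  have hF : ContDiff ℝ 1 F := contDiff_mul_inv_pow hτ0 hτ1 hb hqD.neg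
    (fun s hs ↦ by simp [hqd0 s hs]) _
  have hg0 : ∀ s, b ≤ s → g s = 0 := fun s hs ↦ by simp [g, hq0 s hs]
  have hf0 : ∀ s, b ≤ s → f s = 0 := fun s hs ↦ by simp [f, hq0 s hs]
  have hF0 : ∀ s, b ≤ s → F s = 0 := fun s hs ↦ by simp [F, hqd0 s hs]
  have hFn : ∀ s, 0 ≤ F s := fun s ↦ by
    rcases lt_or_ge s b with h | h
    · exact mul_nonneg (neg_nonneg.2 (hqd s)) (inv_nonneg.2 (pow_nonneg (hP s h).le _))
    · rw [hF0 s h]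
  have hgn : ∀ s, 0 ≤ g s := fun s ↦ by
    rcases lt_or_ge s b with h | h
    · exact mul_nonneg (hqn s) (inv_nonneg.2 (pow_nonneg (hP s h).le _))
    · rw [hg0 s h]
  have tg := isTestFunction_comp_norm_sq (E := E) hb (hg.of_le one_le_two) hg0
  have tf := isTestFunction_comp_norm_sq (E := E) hb hf hf0
  have tF := isTestFunction_comp_norm_sq (E := E) hb hF hF0
  have iF : ∀ {φ : E → ℝ}, Continuous φ → Integrable (fun x ↦ φ x * F (‖x‖ ^ 2)) :=
    fun hφ ↦ tF.integrable_mul hφ.continuousOn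
  have ig : ∀ {φ : E → ℝ}, Continuous φ → Integrable (fun x ↦ φ x * g (‖x‖ ^ 2)) :=
    fun hφ ↦ tg.integrable_mul hφ.continuousOn
  have ig1 : Integrable (fun x : E ↦ g (‖x‖ ^ 2)) := by
    simpa using ig (continuous_const (y := (1 : ℝ)))
  set N := ∫ x : E, g (‖x‖ ^ 2)
  set J := ∫ x : E, ‖x‖ * F (‖x‖ ^ 2)
  have hN : 0 < N := tg.contDiff.continuous.integral_pos_of_hasCompactSupport_nonneg_nonzero
    (x := 0) tg.hasCompactSupport (fun x ↦ hgn _) (by simp [g, hq1 0 (by positivity)])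
  -- the mean value property and the divergence theorem
  have h1 : ∫ x, translationDeriv τ u e x * g (‖x‖ ^ 2) = fderiv ℝ u 0 e * N := by
    rw [integral_mul_radial_eq_of_integral_mul_div_eq_zero (continuousOn_translationDeriv hu τ e)
      (fun g b hb hg hg0 ↦
        hw.integral_translationDeriv_mul_div hτ1 (by omega) hu e hb hg hg0) hb hg hg0]
    simp [translationDeriv, N]
  have h2 : ∫ x, translationDeriv τ u e x * g (‖x‖ ^ 2) =
      2 * ∫ x, u x * (⟪e, x⟫ * F (‖x‖ ^ 2)) := by
    have hgC := hg.of_le one_le_two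
    have h := integral_fderiv_apply_radial_field hu hb
      (α := fun s ↦ (1 + τ * s) * g s) (β := fun s ↦ -(2 * τ) * g s) (by fun_prop) (by fun_prop)
      (fun s hs ↦ by simp [hg0 s hs]) (fun s hs ↦ by simp [hg0 s hs]) e
    have hl : ∀ x, translationDeriv τ u e x * g (‖x‖ ^ 2) = fderiv ℝ u x
        (((1 + τ * ‖x‖ ^ 2) * g (‖x‖ ^ 2)) • e + (⟪e, x⟫ * (-(2 * τ) * g (‖x‖ ^ 2))) • x) := by
      intro x
      simp only [translationDeriv, map_add, map_sub, map_smul, smul_eq_mul]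
      ring
    have hr : ∀ s, 2 * deriv (fun s ↦ (1 + τ * s) * g s) s +
        2 * s * deriv (fun s ↦ -(2 * τ) * g s) s + (finrank ℝ E + 1) * (-(2 * τ) * g s) =
        -2 * F s := by
      intro s
      have hd := (hg.differentiable two_ne_zero s).hasDerivAt
      rw [((((hasDerivAt_id' s).const_mul τ).const_add 1).fun_mul hd).deriv,
        (hd.const_mul (-(2 * τ))).deriv, hk']
      rcases lt_or_ge s b with hs | hs
      · have hne := (hP s hs).ne'
        rw [(hinv (k + 1) s hs).deriv]
        simp only [g, F]
        push_cast
        field_simp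
        ring
      · have : deriv g s = 0 := deriv_eq_zero_of_eq_zero_of_le (hg.of_le one_le_two) hg0 hs
        rw [this, hg0 s hs, hF0 s hs]
        ring
    simp_rw [hl, h, hr]
    rw [← integral_const_mul, ← integral_neg]
    congr with x
    ring
  have h3 : |∫ x, u x * (⟪e, x⟫ * F (‖x‖ ^ 2))| ≤ M * (1 / 2 * J) := by
    calc |∫ x, u x * (⟪e, x⟫ * F (‖x‖ ^ 2))| ≤ ∫ x, M * (|⟪e, x⟫| * F (‖x‖ ^ 2)) := by
          rw [← norm_eq_abs]
          refine norm_integral_le_of_norm_le ((iF (by fun_prop)).const_mul M)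
            (Filter.Eventually.of_forall fun x ↦ ?_)
          by_cases hx : x ∈ ball (0 : E) 1
          · rw [norm_mul, norm_mul, norm_eq_abs, norm_eq_abs, norm_eq_abs, abs_of_nonneg (hFn _)]
            exact mul_le_mul_of_nonneg_right (hM x hx) (mul_nonneg (abs_nonneg _) (hFn _))
          · rw [hF0 _ (not_le.1 fun h ↦ hx (setOf_norm_sq_le_subset_ball hb h)).le]
            simp
      _ = M * ∫ x, |⟪e, x⟫| * F (‖x‖ ^ 2) := integral_const_mul _ _
      _ ≤ M * (1 / 2 * J) := mul_le_mul_of_nonneg_left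
          (integral_abs_inner_mul_radial_le hE he (f := fun r ↦ F (r ^ 2)) fun r _ ↦ hFn _) hM0
  have h4 : |fderiv ℝ u 0 e| * N ≤ M * J := by
    have h := h2.symm.trans h1
    rw [← abs_of_pos hN, ← abs_mul, ← h, abs_mul, abs_two]
    linarith
  -- The divergence of `f(|x|²)x` integrates to zero; its `q'` part is the left side.
  have h5 : ∫ x : E, 2 * ‖x‖ ^ 2 * F (‖x‖ ^ 2) =
      ∫ x : E, (finrank ℝ E + τ * (finrank ℝ E - 2) * ‖x‖ ^ 2) * g (‖x‖ ^ 2) := by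
    have h := tf.integral_fderiv_apply_self
    rw [← sub_eq_zero, ← integral_sub (iF (by fun_prop)) (ig (by fun_prop)), ← neg_eq_zero,
      ← integral_neg, ← h]
    congr with x
    have hd := hasFDerivAt_comp_norm_sq (x := x)
      (hf.differentiable one_ne_zero (‖x‖ ^ 2)).hasDerivAt
    rw [hd.fderiv]
    simp only [smul_apply, coe_innerSL_apply, real_inner_self_eq_norm_sq, smul_eq_mul]
    generalize ‖x‖ ^ 2 = s
    rcases lt_or_ge s b with hs | hs
    · have hne := (hP s hs).ne'
      rw [(hinv k s hs).deriv, hk']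
      simp only [g, F, f, pow_succ, mul_inv]
      linear_combination q s * ((1 - τ * s) ^ k)⁻¹ * (k + 1) * inv_mul_cancel₀ hne
    · have : deriv f s = 0 := deriv_eq_zero_of_eq_zero_of_le hf hf0 hs
      rw [this, hg0 s hs, hF0 s hs, hf0 s hs]
      ring
  have h6 : ∫ x : E, (finrank ℝ E + τ * (finrank ℝ E - 2) * ‖x‖ ^ 2) * g (‖x‖ ^ 2) ≤
      (finrank ℝ E + τ * (finrank ℝ E - 2)) * N := by
    rw [← integral_const_mul]
    refine integral_mono (ig (by fun_prop)) (ig1.const_mul _) fun x ↦ ?_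
    rcases lt_or_ge (‖x‖ ^ 2) b with hs | hs
    · refine mul_le_mul_of_nonneg_right ?_ (hgn _)
      have hd : (0 : ℝ) ≤ finrank ℝ E - 2 := by
        have : (3 : ℝ) ≤ finrank ℝ E := by exact_mod_cast hE
        linarith
      have := mul_le_mul_of_nonneg_left (hs.trans hb).le (mul_nonneg hτ0 hd)
      linarith
    · simp [hg0 _ hs]
  -- Where `F` does not vanish, `R ≤ |x|`.
  have h7 : 2 * R * J ≤ ∫ x : E, 2 * ‖x‖ ^ 2 * F (‖x‖ ^ 2) := by
    rw [← integral_const_mul]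
    refine integral_mono ((iF continuous_norm).const_mul _) (iF (by fun_prop)) fun x ↦ ?_
    rcases lt_or_ge ‖x‖ R with hs | hs
    · have : F (‖x‖ ^ 2) = 0 := by
        simp [F, hqd1 _ (by nlinarith [norm_nonneg x] : ‖x‖ ^ 2 < R ^ 2)]
      simp [this]
    · have h := mul_nonneg (mul_nonneg (norm_nonneg x) (sub_nonneg.2 hs)) (hFn (‖x‖ ^ 2))
      change 2 * R * (‖x‖ * F (‖x‖ ^ 2)) ≤ 2 * ‖x‖ ^ 2 * F (‖x‖ ^ 2)
      nlinarith
  have h8 := mul_le_mul_of_nonneg_left (h7.trans (h5.le.trans h6)) hM0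
  have h9 := mul_le_mul_of_nonneg_right h4 hR0.le
  refine le_of_mul_le_mul_right ?_ hN
  nlinarith

/-- Sharp gradient bound at the centre of the ball for bounded solutions. -/
theorem IsWeaklyHarmonic.abs_fderiv_zero_le {τ : ℝ} (hτ0 : 0 ≤ τ) (hτ1 : τ ≤ 1)
    (hE : 3 ≤ finrank ℝ E) {u : E → ℝ} (hu : ContDiffOn ℝ 1 u (ball 0 1))
    (hw : IsWeaklyHarmonic τ u) {M : ℝ} (hM : ∀ x ∈ ball 0 1, |u x| ≤ M) (v : E) :
    |fderiv ℝ u 0 v| ≤ (finrank ℝ E + τ * (finrank ℝ E - 2)) / 2 * M * ‖v‖ := by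
  rcases eq_or_ne v 0 with rfl | hv
  · simp
  have hv' := norm_pos_iff.2 hv
  have he : ‖‖v‖⁻¹ • v‖ = 1 := norm_smul_inv_norm hv
  have h : |fderiv ℝ u 0 (‖v‖⁻¹ • v)| ≤ (finrank ℝ E + τ * (finrank ℝ E - 2)) / 2 * M := by
    have hlim : Filter.Tendsto (fun R : ℝ ↦ |fderiv ℝ u 0 (‖v‖⁻¹ • v)| * R) (nhdsWithin 1 (Iio 1))
        (nhds (|fderiv ℝ u 0 (‖v‖⁻¹ • v)| * 1)) :=
      ((continuous_const.mul continuous_id).tendsto 1).mono_left nhdsWithin_le_nhds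
    rw [mul_one] at hlim
    refine le_of_tendsto hlim ?_
    filter_upwards [Ioo_mem_nhdsLT zero_lt_one] with R hR
    exact hw.abs_fderiv_zero_mul_le hτ0 hτ1 hE hu hM he hR.1 hR.2
  rw [map_smul, smul_eq_mul, abs_mul, abs_of_pos (inv_pos.2 hv'), inv_mul_le_iff₀ hv'] at h
  linarith

end GradientBound

/-! ### From the classical to the weak equation. -/

section StrongToWeak

variable {E : Type*} [NormedAddCommGroup E] [InnerProductSpace ℝ E] [FiniteDimensional ℝ E]
  [MeasurableSpace E] [BorelSpace E]

/-- Classical solutions are weak solutions. -/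
theorem isWeaklyHarmonic_of_laplacian {τ : ℝ} (hτ1 : τ ≤ 1) (hE : 2 ≤ finrank ℝ E) {u : E → ℝ}
    (hu : ContDiffOn ℝ 2 u (ball 0 1))
    (h : ∀ x ∈ ball (0 : E) 1, (1 - τ * ‖x‖ ^ 2) * Laplacian.laplacian u x +
      2 * τ * (finrank ℝ E - 2) * fderiv ℝ u x x = 0) : IsWeaklyHarmonic τ u := by
  intro w hw
  obtain ⟨k, hk⟩ : ∃ k, finrank ℝ E = k + 2 := ⟨finrank ℝ E - 2, by omega⟩
  have hk' : (finrank ℝ E : ℝ) = k + 2 := by rw [hk]; push_cast; ring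
  rw [hk, Nat.add_sub_cancel]
  let b := stdOrthonormalBasis ℝ E
  have hPne : ∀ x ∈ ball (0 : E) 1, 1 - τ * ‖x‖ ^ 2 ≠ 0 :=
    fun x hx ↦ (one_sub_mul_norm_sq_pos hτ1 hx).ne'
  have hρ : ContDiffOn ℝ 1 (fun x : E ↦ ((1 - τ * ‖x‖ ^ 2) ^ k)⁻¹) (ball 0 1) :=
    ContDiffOn.inv ((contDiff_const.sub (contDiff_const.mul (contDiff_norm_sq ℝ))).pow k).contDiffOn
      fun x hx ↦ pow_ne_zero _ (hPne x hx)
  have hfd : ContDiffOn ℝ 1 (fderiv ℝ u) (ball 0 1) :=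
    hu.fderiv_of_isOpen isOpen_ball (by norm_num)
  have ht : ∀ i, IsTestFunction (ball 0 1)
      (fun x ↦ ((1 - τ * ‖x‖ ^ 2) ^ k)⁻¹ * fderiv ℝ u x (b i) * w x) := fun i ↦
    hw.mul_left isOpen_ball (hρ.mul (hfd.clm_apply contDiffOn_const))
  -- With `ρ` the weight, the divergence of `wρ∇u` is `ρ∇u·∇w + w div(ρ∇u)`, and the classical
  -- equation says `div(ρ∇u) = 0`.
  have hptw : ∀ x, ((1 - τ * ‖x‖ ^ 2) ^ k)⁻¹ * fderiv ℝ u x (gradient w x) =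
      ∑ i, fderiv ℝ (fun x ↦ ((1 - τ * ‖x‖ ^ 2) ^ k)⁻¹ * fderiv ℝ u x (b i) * w x) x (b i) := by
    intro x
    by_cases hx : x ∈ ball (0 : E) 1
    · have hne := hPne x hx
      have hPd : HasDerivAt (fun s : ℝ ↦ ((1 - τ * s) ^ k)⁻¹)
          (k * τ * ((1 - τ * ‖x‖ ^ 2) ^ (k + 1))⁻¹) (‖x‖ ^ 2) := by
        have h1 : HasDerivAt (fun s : ℝ ↦ 1 - τ * s) (-τ) (‖x‖ ^ 2) := by
          simpa using ((hasDerivAt_id' (‖x‖ ^ 2)).const_mul τ).const_sub 1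
        refine ((h1.fun_pow k).fun_inv (pow_ne_zero _ hne)).congr_deriv ?_
        rcases k with _ | j
        · simp
        · rw [Nat.add_sub_cancel]; field_simp; ring
      have hρd := hasFDerivAt_comp_norm_sq hPd
      have hwd := (hw.contDiff.differentiable one_ne_zero x).hasFDerivAt
      have hud : HasFDerivAt (fderiv ℝ u) (fderiv ℝ (fderiv ℝ u) x) x :=
        ((hfd.contDiffAt (isOpen_ball.mem_nhds hx)).differentiableAt one_ne_zero).hasFDerivAt
      have hterm : ∀ i, fderiv ℝ
          (fun x ↦ ((1 - τ * ‖x‖ ^ 2) ^ k)⁻¹ * fderiv ℝ u x (b i) * w x) x (b i) =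
          ((1 - τ * ‖x‖ ^ 2) ^ k)⁻¹ * fderiv ℝ u x (⟪b i, gradient w x⟫ • b i) +
          w x * (2 * (k * τ * ((1 - τ * ‖x‖ ^ 2) ^ (k + 1))⁻¹) *
            fderiv ℝ u x (⟪b i, x⟫ • b i) +
            ((1 - τ * ‖x‖ ^ 2) ^ k)⁻¹ * iteratedFDeriv ℝ 2 u x ![b i, b i]) := by
        intro i
        rw [((hρd.fun_mul (hud.clm_apply (hasFDerivAt_const (b i) x))).fun_mul hwd).fderiv,
          real_inner_comm, ← InnerProductSpace.toDual_apply_apply (𝕜 := ℝ),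
          toDual_gradient, iteratedFDeriv_two_apply]
        simp [real_inner_comm x]
        ring
      have hlap : Laplacian.laplacian u x = ∑ i, iteratedFDeriv ℝ 2 u x ![b i, b i] :=
        congrFun (InnerProductSpace.laplacian_eq_iteratedFDeriv_orthonormalBasis u b) x
      have hx0 := h x hx
      rw [hk'] at hx0
      simp_rw [hterm, Finset.sum_add_distrib, ← Finset.mul_sum, Finset.sum_add_distrib,
        ← Finset.mul_sum, ← map_sum, b.sum_repr', ← hlap]
      have : 2 * (k * τ * ((1 - τ * ‖x‖ ^ 2) ^ (k + 1))⁻¹) * fderiv ℝ u x x +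
          ((1 - τ * ‖x‖ ^ 2) ^ k)⁻¹ * Laplacian.laplacian u x = 0 := by
        field_simp
        linear_combination (1 - τ * ‖x‖ ^ 2) ^ k * hx0
      rw [this]; ring
    · have hx' : x ∉ tsupport w := fun h ↦ hx (hw.tsupport_subset h)
      have hx2 : ∀ i, x ∉ tsupport
          fun x ↦ ((1 - τ * ‖x‖ ^ 2) ^ k)⁻¹ * fderiv ℝ u x (b i) * w x :=
        fun i h ↦ hx ((ht i).tsupport_subset h)
      simp [gradient, fderiv_eq_zero_of_notMem_tsupport hx',
        fderiv_eq_zero_of_notMem_tsupport (hx2 _)]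
  simp_rw [hptw]
  rw [integral_finsetSum _ fun i _ ↦ (ht i).integrable_fderiv_apply continuous_const]
  exact Finset.sum_eq_zero fun i _ ↦ (ht i).integral_fderiv_apply_const _

end StrongToWeak

/-! ### Conformal invariance of the weak equation. -/

section ConformalChange

variable {E : Type*} [NormedAddCommGroup E] [InnerProductSpace ℝ E]

/-- The image of the support under `T` is compact, hence closed, so `S` itself need not be
continuous. -/
theorem IsTestFunction.tsupport_comp_subset {U : Set E} {w : E → ℝ} (hw : IsTestFunction U w)
    {S T : E → E} (hTS : ∀ x, T (S x) = x) (hT : ContinuousOn T U) :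
    tsupport (fun x ↦ w (S x)) ⊆ T '' tsupport w :=
  closure_minimal (fun x hx ↦ ⟨S x, subset_tsupport w hx, hTS x⟩)
    (hw.hasCompactSupport.isCompact.image_of_continuousOn (hT.mono hw.tsupport_subset)).isClosed

theorem IsTestFunction.comp {U U' : Set E} {w : E → ℝ} (hw : IsTestFunction U w) {S T : E → E}
    (hTS : ∀ x, T (S x) = x) (hT : ContinuousOn T U) (hTU : MapsTo T U U')
    (hS : ∀ x ∈ U', ContDiffAt ℝ 1 S x) : IsTestFunction U' (fun x ↦ w (S x)) := by
  have hsub := hw.tsupport_comp_subset hTS hT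
  have hU' : T '' tsupport w ⊆ U' := (hTU.mono_left hw.tsupport_subset).image_subset
  exact ⟨contDiff_of_contDiffAt_tsupport fun x hx ↦
      hw.contDiff.contDiffAt.comp x (hS x (hU' (hsub hx))),
    (hw.hasCompactSupport.isCompact.image_of_continuousOn
      (hT.mono hw.tsupport_subset)).of_isClosed_subset (isClosed_tsupport _) hsub, hsub.trans hU'⟩

variable [FiniteDimensional ℝ E] [MeasurableSpace E] [BorelSpace E]

/-- Weak solutions are preserved by conformal changes of variables that rescale the weight
accordingly. -/
theorem IsWeaklyHarmonic.comp {τ : ℝ} (hτ1 : τ ≤ 1) (hE : 2 ≤ finrank ℝ E) {u : E → ℝ}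
    (hu : ContDiffOn ℝ 1 u (ball 0 1)) (hw : IsWeaklyHarmonic τ u) {S T : E → E}
    (hTS : ∀ x, T (S x) = x) (hST : ∀ x, S (T x) = x) (hTU : MapsTo T (ball 0 1) (ball 0 1))
    (hS : ∀ x ∈ ball 0 1, ContDiffAt ℝ 1 S x) {l : E → ℝ} {O : E → E ≃ₗᵢ[ℝ] E} {C : ℝ} (hC : C ≠ 0)
    (hT : ∀ x ∈ ball 0 1, HasFDerivAt T (l x • (O x : E →L[ℝ] E)) x)
    (hl : ∀ x ∈ ball 0 1, 0 < l x)
    (hP : ∀ x ∈ ball 0 1, 1 - τ * ‖T x‖ ^ 2 = C * l x * (1 - τ * ‖x‖ ^ 2)) :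
    IsWeaklyHarmonic τ fun x ↦ u (T x) := by
  intro w' hw'
  obtain ⟨k, hk⟩ : ∃ k, finrank ℝ E = k + 2 := ⟨finrank ℝ E - 2, by omega⟩
  have hTc : ContinuousOn T (ball 0 1) :=
    fun x hx ↦ (hT x hx).continuousAt.continuousWithinAt
  have htest : IsTestFunction (ball 0 1) fun x ↦ w' (S x) := hw'.comp hTS hTc hTU hS
  have h := hw _ htest
  rw [hk, Nat.add_sub_cancel] at h ⊢
  have hzero : ∀ x ∉ T '' ball 0 1, ((1 - τ * ‖x‖ ^ 2) ^ k)⁻¹ *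
      fderiv ℝ u x (gradient (fun x ↦ w' (S x)) x) = 0 := by
    intro x hx
    have hx' : x ∉ tsupport fun x ↦ w' (S x) := by
      intro hmem
      obtain ⟨y, hy, rfl⟩ := hw'.tsupport_comp_subset hTS hTc hmem
      exact hx ⟨y, hw'.tsupport_subset hy, rfl⟩
    simp [gradient, fderiv_eq_zero_of_notMem_tsupport hx']
  rw [← setIntegral_eq_integral_of_forall_compl_eq_zero hzero,
    integral_image_eq_integral_abs_det_fderiv_smul volume measurableSet_ball
      (fun x hx ↦ (hT x hx).hasFDerivWithinAt)
      (Function.LeftInverse.injective hST).injOn] at h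
  have hzero' : ∀ x ∉ ball (0 : E) 1, ((1 - τ * ‖x‖ ^ 2) ^ k)⁻¹ *
      fderiv ℝ (fun x ↦ u (T x)) x (gradient w' x) = 0 := by
    intro x hx
    have hx' : x ∉ tsupport w' := fun h ↦ hx (hw'.tsupport_subset h)
    simp [gradient, fderiv_eq_zero_of_notMem_tsupport hx']
  rw [← setIntegral_eq_integral_of_forall_compl_eq_zero hzero']
  -- The Jacobian contributes `l^(k+2)`, the two gradients absorb `l²` and the weight absorbs `l^k`.
  -- The constant `C^(-k)` is all that remains.
  rw [← mul_eq_zero_iff_left (inv_ne_zero (pow_ne_zero k hC)), ← integral_const_mul, ← h]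
  refine setIntegral_congr_fun measurableSet_ball fun x hx ↦ ?_
  have hl0 := hl x hx
  have hdet : |(l x • (O x : E →L[ℝ] E)).det| = l x ^ (k + 2) := by
    have : (l x • (O x : E →L[ℝ] E)).det = l x ^ (k + 2) *
        LinearMap.det ((O x).toLinearEquiv : E →ₗ[ℝ] E) := by
      rw [← hk]
      exact LinearMap.det_smul (l x) ((O x).toLinearEquiv : E →ₗ[ℝ] E)
    rw [this, abs_mul, abs_of_pos (by positivity)]
    rw [← LinearMap.normDet_eq_abs_det]
    exact (congrArg _ (O x).toLinearIsometry.normDet_eq_one).trans (mul_one _)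
  have hud := ((hu.contDiffAt (isOpen_ball.mem_nhds (hTU hx))).differentiableAt
    one_ne_zero).hasFDerivAt
  have hwd := (htest.contDiff.differentiable one_ne_zero (T x)).hasFDerivAt
  have hgrad : gradient w' x = l x • (O x).symm (gradient (fun x ↦ w' (S x)) (T x)) := by
    have h1 := hwd.comp x (hT x hx)
    simp only [Function.comp_def, hST] at h1
    refine HasGradientAt.gradient ?_
    rw [hasGradientAt_iff_hasFDerivAt]
    refine h1.congr_fderiv ?_
    ext v
    rw [← toDual_gradient]
    simp [(O x).symm.inner_map_eq_flip]
  have hcomp := (hud.comp x (hT x hx)).fderiv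
  simp only [Function.comp_def] at hcomp
  simp only [hdet, hcomp, hgrad, hP x hx, smul_eq_mul]
  have hne := (one_sub_mul_norm_sq_pos hτ1 hx).ne'
  generalize 1 - τ * ‖x‖ ^ 2 = P at hne ⊢
  simp
  field_simp
  ring

end ConformalChange

/-! ### Inversions that preserve the unit sphere. -/

section Inversion

variable {E : Type*} [NormedAddCommGroup E] [InnerProductSpace ℝ E]

open EuclideanGeometry in
/-- The inversion in a sphere orthogonal to the unit sphere preserves the unit sphere, with the
conformal factor of the hyperbolic metric. -/
theorem one_sub_norm_inversion_sq {c x : E} {R : ℝ} (hR : R ^ 2 = ‖c‖ ^ 2 - 1) (hx : x ≠ c) :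
    1 - ‖inversion c R x‖ ^ 2 = (R / dist x c) ^ 2 * (1 - ‖x‖ ^ 2) := by
  have hd : dist x c ≠ 0 := dist_ne_zero.2 hx
  have h1 : inversion c R x = (R / dist x c) ^ 2 • (x - c) + c := rfl
  have h2 : (R / dist x c) ^ 2 * ‖x - c‖ ^ 2 = R ^ 2 := by
    rw [← dist_eq_norm]; field_simp
  have h3 := norm_sub_sq_real x c
  rw [h1, norm_add_sq_real, norm_smul, inner_smul_left, inner_sub_left, mul_pow, norm_eq_abs,
    sq_abs, real_inner_self_eq_norm_sq]
  simp only [RCLike.conj_to_real]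
  linear_combination (1 - (R / dist x c) ^ 2) * h2 - (R / dist x c) ^ 2 * (h3 + hR) + hR

end Inversion

/-! ### Transport of the central bound to an arbitrary point. -/

section PointwiseBounds

variable {E : Type*} [NormedAddCommGroup E] [InnerProductSpace ℝ E] [FiniteDimensional ℝ E]
  [MeasurableSpace E] [BorelSpace E]

/-- Gradient bound for bounded harmonic functions on the unit ball. -/
theorem IsWeaklyHarmonic.abs_fderiv_le_of_flat (hE : 3 ≤ finrank ℝ E) {u : E → ℝ}
    (hu : ContDiffOn ℝ 1 u (ball 0 1)) (hw : IsWeaklyHarmonic 0 u) {M : ℝ}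
    (hM : ∀ x ∈ ball 0 1, |u x| ≤ M) {a : E} (ha : a ∈ ball (0 : E) 1) (v : E) :
    |fderiv ℝ u a v| ≤ finrank ℝ E / 2 * (1 / (1 - ‖a‖)) * M * ‖v‖ := by
  have hr : 0 < 1 - ‖a‖ := sub_pos.2 (mem_ball_zero_iff.1 ha)
  set r := 1 - ‖a‖ with hrdef
  let T : E → E := fun x ↦ a + r • x
  have hTU : MapsTo T (ball 0 1) (ball 0 1) := by
    intro x hx
    rw [mem_ball_zero_iff] at hx ⊢
    calc ‖a + r • x‖ ≤ ‖a‖ + r * ‖x‖ := by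
          refine (norm_add_le _ _).trans_eq ?_
          rw [norm_smul, norm_eq_abs, abs_of_pos hr]
      _ < ‖a‖ + r * 1 := by gcongr
      _ = 1 := by rw [hrdef]; ring
  have hTd : ∀ x, HasFDerivAt T (r • ((LinearIsometryEquiv.refl ℝ E : E ≃ₗᵢ[ℝ] E) : E →L[ℝ] E)) x :=
    fun x ↦ ((hasFDerivAt_id x).const_smul r).const_add a
  have hv := hw.comp zero_le_one (by omega) hu (S := fun x ↦ r⁻¹ • (x - a)) (T := T)
    (l := fun _ ↦ r) (C := r⁻¹) (fun x ↦ by simp [T, smul_smul, hr.ne'])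
    (fun x ↦ by simp [T, smul_smul, hr.ne']) hTU (fun x _ ↦ by fun_prop) (inv_ne_zero hr.ne')
    (fun x _ ↦ hTd x) (fun _ _ ↦ hr) (fun x _ ↦ by simp [hr.ne'])
  have hvC : ContDiffOn ℝ 1 (fun x ↦ u (T x)) (ball 0 1) :=
    hu.comp (ContDiff.contDiffOn (by fun_prop)) hTU
  have h := hv.abs_fderiv_zero_le le_rfl zero_le_one hE hvC (fun x hx ↦ hM _ (hTU hx)) v
  have hT0 : T 0 = a := by simp [T]
  have hud := ((hu.contDiffAt (isOpen_ball.mem_nhds ha)).differentiableAt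
    one_ne_zero).hasFDerivAt
  rw [← hT0] at hud
  have hc := (hud.comp 0 (hTd 0)).fderiv
  simp only [Function.comp_def, hT0] at hc
  rw [hc] at h
  simp [abs_of_pos hr] at h
  rw [mul_comm r, ← le_div_iff₀ hr] at h
  refine h.trans_eq ?_
  field_simp

open EuclideanGeometry in
/-- Gradient bound for bounded hyperbolic harmonic functions on the unit ball. -/
theorem IsWeaklyHarmonic.abs_fderiv_le_of_hyperbolic (hE : 3 ≤ finrank ℝ E) {u : E → ℝ}
    (hu : ContDiffOn ℝ 1 u (ball 0 1)) (hw : IsWeaklyHarmonic 1 u) {M : ℝ}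
    (hM : ∀ x ∈ ball 0 1, |u x| ≤ M) {a : E} (ha : a ∈ ball (0 : E) 1) (v : E) :
    |fderiv ℝ u a v| ≤ (finrank ℝ E - 1) * (1 / (1 - ‖a‖ ^ 2)) * M * ‖v‖ := by
  rcases eq_or_ne a 0 with rfl | ha0
  · refine (hw.abs_fderiv_zero_le zero_le_one le_rfl hE hu hM v).trans_eq ?_
    rw [norm_zero]; ring
  have hna : 0 < ‖a‖ := norm_pos_iff.2 ha0
  have hna1 : 0 < 1 - ‖a‖ ^ 2 := sub_pos.2 (norm_sq_lt_one_of_mem_ball ha)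
  -- The centre is the mirror image of `a` in the unit sphere. With `R² = |c|² - 1` the inversion
  -- sphere is orthogonal to the unit sphere, and the inversion exchanges `0` and `a`, scaling
  -- lengths at `0` by `1 - |a|²`.
  set c : E := (‖a‖ ^ 2)⁻¹ • a
  have hc : ‖c‖ = ‖a‖⁻¹ := by
    simp only [c, norm_smul, norm_inv, norm_pow, norm_norm]
    field_simp
  have hc1 : 1 < ‖c‖ := by
    rw [hc]; exact (one_lt_inv₀ hna).2 (mem_ball_zero_iff.1 ha)
  obtain ⟨R, hR0, hR⟩ : ∃ R : ℝ, 0 < R ∧ R ^ 2 = ‖c‖ ^ 2 - 1 :=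
    ⟨√(‖c‖ ^ 2 - 1), sqrt_pos.2 (by nlinarith), sq_sqrt (by nlinarith)⟩
  have hne : ∀ x ∈ ball (0 : E) 1, x ≠ c := by
    rintro x hx rfl
    exact lt_asymm hc1 (mem_ball_zero_iff.1 hx)
  let l : E → ℝ := fun x ↦ (R / dist x c) ^ 2
  have hl : ∀ x ∈ ball (0 : E) 1, 0 < l x := fun x hx ↦ by
    have := dist_pos.2 (hne x hx)
    positivity
  have hP : ∀ x ∈ ball (0 : E) 1, 1 - ‖inversion c R x‖ ^ 2 = l x * (1 - ‖x‖ ^ 2) :=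
    fun x hx ↦ one_sub_norm_inversion_sq hR (hne x hx)
  have hTU : MapsTo (inversion c R) (ball (0 : E) 1) (ball 0 1) := by
    intro x hx
    have h := mul_pos (hl x hx) (sub_pos.2 (norm_sq_lt_one_of_mem_ball hx))
    rw [← hP x hx] at h
    rw [mem_ball_zero_iff]
    nlinarith [norm_nonneg (inversion c R x)]
  have hTC : ∀ x ∈ ball (0 : E) 1, ContDiffAt ℝ 1 (inversion c R) x := fun x hx ↦
    contDiffAt_const.inversion contDiffAt_const contDiffAt_id (hne x hx)
  have hTd : ∀ x ∈ ball (0 : E) 1, HasFDerivAt (inversion c R)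
      (l x • ((ℝ ∙ (x - c))ᗮ.reflection : E →L[ℝ] E)) x :=
    fun x hx ↦ hasFDerivAt_inversion (hne x hx)
  have hv := hw.comp le_rfl (by omega) hu (S := inversion c R) (T := inversion c R)
    (inversion_inversion c hR0.ne') (inversion_inversion c hR0.ne') hTU hTC one_ne_zero
    hTd hl (fun x hx ↦ by rw [one_mul, one_mul, one_mul, hP x hx])
  have hvC : ContDiffOn ℝ 1 (fun x ↦ u (inversion c R x)) (ball 0 1) :=
    hu.comp (fun x hx ↦ (hTC x hx).contDiffWithinAt) hTU
  have h0 : (0 : E) ∈ ball (0 : E) 1 := by simp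
  have hl0 : l 0 = 1 - ‖a‖ ^ 2 := by
    simp only [l, dist_zero_left, div_pow, hR, hc]
    field_simp
  have hT0 : inversion c R 0 = a := by
    have : inversion c R 0 = l 0 • (0 - c) + c := rfl
    rw [this, hl0]
    simp only [c, zero_sub, smul_neg, smul_smul]
    rw [← neg_smul, ← add_smul]
    convert one_smul ℝ a using 2
    field_simp
    ring
  set O := (ℝ ∙ ((0 : E) - c))ᗮ.reflection
  -- Testing with `O v` lets the reflection in the derivative of the inversion cancel, leaving a
  -- multiple of `v`.
  have h := hv.abs_fderiv_zero_le zero_le_one le_rfl hE hvC (fun x hx ↦ hM _ (hTU hx)) (O v)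
  have hud := ((hu.contDiffAt (isOpen_ball.mem_nhds ha)).differentiableAt
    one_ne_zero).hasFDerivAt
  rw [← hT0] at hud
  have hcomp := (hud.comp 0 (hTd 0 h0)).fderiv
  simp only [Function.comp_def, hT0] at hcomp
  have hOO : O (O v) = v := Submodule.reflection_reflection _ v
  rw [hcomp, hl0, O.norm_map] at h
  change |fderiv ℝ u a ((1 - ‖a‖ ^ 2) • O (O v))| ≤ _ at h
  rw [hOO, map_smul, smul_eq_mul, abs_mul, abs_of_pos hna1, mul_comm, ← le_div_iff₀ hna1] at h
  refine h.trans_eq ?_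
  field_simp
  ring

end PointwiseBounds

/-! ### Vector-valued maps and the final assembly. -/

section VectorValued

variable {E F : Type*} [NormedAddCommGroup E] [InnerProductSpace ℝ E]
  [NormedAddCommGroup F] [InnerProductSpace ℝ F]

/-- An operator norm bound for the derivative of a vector-valued map, deduced from bounds for the
derivatives of all its scalar components. -/
theorem norm_fderiv_le_of_abs_fderiv_inner_le {h : E → F} {x : E} (hd : DifferentiableAt ℝ h x)
    {K : ℝ} (hK : 0 ≤ K) (hb : ∀ (w : F) (v : E),
      |fderiv ℝ (fun y ↦ ⟪w, h y⟫) x v| ≤ K * ‖w‖ * ‖v‖) : ‖fderiv ℝ h x‖ ≤ K := by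
  refine ContinuousLinearMap.opNorm_le_bound _ hK fun v ↦ ?_
  rcases eq_or_ne (fderiv ℝ h x v) 0 with h0 | h0
  · rw [h0, norm_zero]; positivity
  -- Testing against the derivative's own value gives `|Dh v|² ≤ K |Dh v| |v|`.
  have hb' := hb (fderiv ℝ h x v) v
  have hc := (((innerSL ℝ (fderiv ℝ h x v)).hasFDerivAt).comp x hd.hasFDerivAt).fderiv
  simp only [Function.comp_def, coe_innerSL_apply] at hc
  rw [hc] at hb'
  simp only [ContinuousLinearMap.comp_apply, coe_innerSL_apply, real_inner_self_eq_norm_sq,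
    abs_pow, abs_norm] at hb'
  have := norm_pos_iff.2 h0
  refine le_of_mul_le_mul_right ?_ this
  nlinarith

end VectorValued

theorem mainTheorem8 (n m : ℕ) (hn : 3 ≤ n) (hm : 1 ≤ m)
    (h : EuclideanSpace ℝ (Fin n) → EuclideanSpace ℝ (Fin m))
    (hmaps : Set.MapsTo h (unitBall n) (unitBall m)) :
    (InnerProductSpace.HarmonicOnNhd h (unitBall n) →
      ∀ x ∈ unitBall n, ‖fderiv ℝ h x‖ ≤ (n : ℝ) / 2 * (1 / (1 - ‖x‖))) ∧
    (IsHyperbolicHarmonicOnBall h →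
      ∀ x ∈ unitBall n, ‖fderiv ℝ h x‖ ≤ ((n : ℝ) - 1) * (1 / (1 - ‖x‖ ^ 2))) := by
  have hdim : finrank ℝ (EuclideanSpace ℝ (Fin n)) = n := finrank_euclideanSpace_fin
  have hE : 3 ≤ finrank ℝ (EuclideanSpace ℝ (Fin n)) := by rwa [hdim]
  have hn' : (3 : ℝ) ≤ n := by exact_mod_cast hn
  have hbound : ∀ w, ∀ x ∈ ball (0 : EuclideanSpace ℝ (Fin n)) 1, |⟪w, h x⟫| ≤ ‖w‖ := by
    intro w x hx
    refine (abs_real_inner_le_norm _ _).trans (mul_le_of_le_one_right (norm_nonneg _) ?_)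
    exact (mem_ball_zero_iff.1 (hmaps hx)).le
  have hlap : ContDiffOn ℝ 2 h (ball 0 1) → ∀ w, ∀ x ∈ ball (0 : EuclideanSpace ℝ (Fin n)) 1,
      Laplacian.laplacian (fun y ↦ ⟪w, h y⟫) x = ⟪w, Laplacian.laplacian h x⟫ :=
    fun hC w x hx ↦ (hC.contDiffAt (isOpen_ball.mem_nhds hx)).laplacian_CLM_comp_left
      (l := innerSL ℝ w)
  have hdiff : ContDiffOn ℝ 2 h (ball 0 1) → ∀ x ∈ ball (0 : EuclideanSpace ℝ (Fin n)) 1,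
      DifferentiableAt ℝ h x := fun hC x hx ↦
    (hC.contDiffAt (isOpen_ball.mem_nhds hx)).differentiableAt two_ne_zero
  have hinner : ContDiffOn ℝ 2 h (ball 0 1) → ∀ w,
      ContDiffOn ℝ 2 (fun y ↦ ⟪w, h y⟫) (ball 0 1) := fun hC w ↦ contDiffOn_const.inner ℝ hC
  constructor
  · intro hh x hx
    have hx1 : 0 < 1 - ‖x‖ := sub_pos.2 (mem_ball_zero_iff.1 hx)
    have hC : ContDiffOn ℝ 2 h (ball 0 1) := hh.contDiffOn
    refine norm_fderiv_le_of_abs_fderiv_inner_le (hdiff hC x hx) (by positivity) fun w v ↦ ?_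
    have hw : IsWeaklyHarmonic 0 fun y ↦ ⟪w, h y⟫ :=
      isWeaklyHarmonic_of_laplacian zero_le_one (by omega) (hinner hC w) fun y hy ↦ by
        rw [hlap hC w y hy, (hh y hy).2.self_of_nhds]
        simp
    simpa only [hdim] using hw.abs_fderiv_le_of_flat hE ((hinner hC w).of_le one_le_two)
      (hbound w) hx v
  · rintro ⟨hC, hh⟩ x hx
    have hx1 : 0 < 1 - ‖x‖ ^ 2 := sub_pos.2 (norm_sq_lt_one_of_mem_ball hx)
    refine norm_fderiv_le_of_abs_fderiv_inner_le (hdiff hC x hx)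
      (mul_nonneg (by linarith) (by positivity)) fun w v ↦ ?_
    have hw : IsWeaklyHarmonic 1 fun y ↦ ⟪w, h y⟫ :=
      isWeaklyHarmonic_of_laplacian le_rfl (by omega) (hinner hC w) fun y hy ↦ by
        have hy1 : 0 < 1 - ‖y‖ ^ 2 := sub_pos.2 (norm_sq_lt_one_of_mem_ball hy)
        have hc := (((innerSL ℝ w).hasFDerivAt).comp y (hdiff hC y hy).hasFDerivAt).fderiv
        simp only [Function.comp_def, coe_innerSL_apply] at hc
        have hsum : ∑ i, y i • fderiv ℝ h y (EuclideanSpace.single i 1) = fderiv ℝ h y y := by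
          have hy' := (EuclideanSpace.basisFun (Fin n) ℝ).sum_repr y
          simp only [EuclideanSpace.basisFun_repr, EuclideanSpace.basisFun_apply] at hy'
          simp_rw [← map_smul, ← map_sum, hy']
        have h0 := congrArg (fun z ↦ ⟪w, z⟫) (hh y hy)
        simp only [hyperbolicLaplacian, hsum, inner_add_right, inner_smul_right,
          inner_zero_right] at h0
        rw [hlap hC w y hy, hc, hdim]
        simp only [ContinuousLinearMap.comp_apply, coe_innerSL_apply]
        -- `hyperbolicLaplacian` carries one more factor `1 - |y|²` than the equation used for the
        -- weak form.
        refine (mul_eq_zero.1 ?_).resolve_left hy1.ne'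
        linear_combination h0
    simpa only [hdim] using hw.abs_fderiv_le_of_hyperbolic hE ((hinner hC w).of_le one_le_two)
      (hbound w) hx v
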